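/- **Setting.** Let $U:\mathbb R^d\to\mathbb R$ be a measurable energy, $0<\tau_{\min}<\tau_{\max}$, with $\int e^{-U/\tau_{\min}}<\infty$ and $\int e^{-U/\tau_{\max}}<\infty$. For every number of chains $P\ge 2$ let $\tau_{\min}=\tau^{(1)}<\dots<\tau^{(P)}=\tau_{\max}$ be a temperature ladder (depending on $P$), $\pi^{(p)}\propto e^{-U/\tau^{(p)}}$, and $\Delta_\tau=\tau_{\max}/\tau_{\min}$. At iteration $k=0,1,2,\dots$ chain $p$ is in the state $\beta_k^{(p)}$ with stochastic energy estimate $\widetilde U_k^{(p)}$, and a swap attempt of the chains $p,p+1$ is accepted iff $u_k^{(p)}<\widetilde S$, where $u_k^{(p)}$ is uniform on $[0,1]$ and $$\widetilde S=1\wedge\exp\Big(\partial T_p\big(\widetilde U_k^{(p)}-\widetilde U_k^{(p+1)}-\partial T_p\,\sigma_p^2\big)\Big),\qquad \partial T_p=\tfrac1{\tau^{(p)}}-\tfrac1{\tau^{(p+1)}},$$ $2\sigma_p^2$ being the conditional variance of $\widetilde U_k^{(p)}-\widetilde U_k^{(p+1)}$. In the generalized even-odd scheme with window size $W$ the pairs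 $(1,2),(3,4),\dots$ attempt swaps at all iterations of the windows $0,2,4,\dots$ (window $t$ consisting of the iterations $tW,\dots,(t+1)W-1$) and the pairs $(2,3),(4,5),\dots$ at all iterations of the windows $1,3,5,\dots$, each pair being swapped at most once per window. A particle on chain $p$ has upward direction in a window iff $p$ is odd in an even-numbered window or even in an odd-numbered window, and downward direction otherwise. The round trip time $T$ is $W$ times the number of windows that a particle which starts in chain $1$ with upward direction needs to reach chain $P$ with downward direction and then to come back to chain $1$ with upward direction. **Assumptions.** (B1) $\beta_k^{(p)}\sim\pi^{(p)}$ for all $k,p$. (B2) For each $P$, all the energies $U(\beta_k^{(p)})$, estimation errors $\widetilde U_k^{(p)}-U(\beta_k^{(p)})$ and variables $u_k^{(p)}$ ($k\ge 0$, $1\le p\le P$) are mutually independent. (B3) $U^3$ is integrable with respect to $\pi^{(1)}$ and $\pi^{(P)}$. (B4) $\tau^{(p+1)}/\tau^{(p)}=\Delta_\tau^{1/(P-1)}+o(1/P)$ as $P\to\infty$, uniformly in $1\le p\le P-1$. (C1) $\widetilde U_k^{(p)}-U(\beta_k^{(p)})\sim\mathcal N(0,s_p^2)$ for all $k$, so that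 $2\sigma_p^2=s_p^2+s_{p+1}^2$; the $s_p\ge0$ may depend on $P$, but $s_p\le BP$ for a constant $B$ (in particular they may be fixed). Equi-acceptance: for each $P$ the rejection probability of a single swap attempt is the same number $r$ for all pairs $(p,p+1)$. Put $\mu_p=\dfrac{\sigma_p}{\tau^{(p+1)}}\cdot\dfrac{\log\Delta_\tau}{2\sqrt2}$ (depending on $P$ and $p$) and $R_m(x)=x\log x\,\exp(m^2/x^2)$. **Conclusions.** 1. There is a constant $C$ such that for all $P\ge2$, for $W=\max\big(1,\big\lceil\frac{\log P+\log\log P}{-\log r}\big\rceil\big)$ (read as $W=1$ if $r=0$) as well as for any $W\ge 1$ that minimises $\mathbb E[T]$, and for all $1\le p\le P-1$, $$\mathbb E[T]\le C\,P\log P\,\exp\!\big(\mu_p^2/P^2\big)=C\,R_{\mu_p}(P).$$ 2. The optimal number of chains $P_\star$ is the minimiser of this order of the round trip time. For every $P\ge2$ and $1\le q\le P-1$, $R_{\mu_q}$ has exactly one minimiser on the real interval $[4,\infty)$, and it has a minimiser among the integers $\ge4$. If $P_\star$ is any of these (real or integer) minimisers, then $$P_\star>\min_{1\le p\le P-1}\frac{\sigma_p}{3\tau^{(p+1)}}\log\Delta_\tau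 .$$ 3. For all sufficiently large $P$, all $1\le q\le P-1$ and all such minimisers $P_\star$ of $R_{\mu_q}$, moreover $$P_\star>\min_{1\le p\le P-1}\frac{\sigma_p}{3\tau^{(p)}}\log\Delta_\tau .$$ -/

import Mathlib

open MeasureTheory ProbabilityTheory Filter

noncomputable section

namespace PT

/-- `d`-dimensional parameter space. -/
abbrev Space (d : ℕ) := EuclideanSpace ℝ (Fin d)

/-- The Gibbs distribution at temperature `T`: the probability measure proportional to
`exp (-U / T)` with respect to Lebesgue measure. -/
def gibbs {d : ℕ} (U : Space d → ℝ) (T : ℝ) : Measure (Space d) :=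
  (volume : Measure (Space d)).tilted (fun x => -U x / T)

/-- The bias-corrected swap function at temperatures `t₁ < t₂`, evaluated at the noisy energies
`e₁`, `e₂` of the two chains, where `e₁ - e₂` has conditional variance `2 * σ ^ 2`. -/
def swapFn (t₁ t₂ σ e₁ e₂ : ℝ) : ℝ :=
  min 1 (Real.exp ((1 / t₁ - 1 / t₂) * (e₁ - e₂ - (1 / t₁ - 1 / t₂) * σ ^ 2)))

/-- The data of parallel tempering with stochastic energies, for every number of chains `P`.
Chains are numbered `1, …, P`, iterations `0, 1, 2, …`; values at other chain numbers are
never used. This structure carries data only, no property. -/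
structure System (d : ℕ) (Ω : Type*) where
  /-- the energy function -/
  U : Space d → ℝ
  /-- `τ P p` is the temperature of chain `p` among `P` chains -/
  τ : ℕ → ℕ → ℝ
  /-- lowest temperature (that of chain `1`) -/
  τmin : ℝ
  /-- highest temperature (that of chain `P`) -/
  τmax : ℝ
  /-- `s P p` is the standard deviation of the stochastic energy estimator of chain `p` -/
  s : ℕ → ℕ → ℝ
  /-- `β P k p` is the state of chain `p` at iteration `k`, when swaps are attempted -/
  β : ℕ → ℕ → ℕ → Ω → Space d
  /-- `E P k p` is the stochastic estimate of the energy `U (β P k p)` -/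
  E : ℕ → ℕ → ℕ → Ω → ℝ
  /-- `u P k p` is the uniform variable deciding the swap attempt of chains `p`, `p + 1` -/
  u : ℕ → ℕ → ℕ → Ω → ℝ

namespace System

variable {d : ℕ} {Ω : Type*} [MeasurableSpace Ω] (S : System d Ω) (Pr : Measure Ω)

/-- `σ_p`, so that the difference of the energy estimators of chains `p` and `p + 1` has
conditional variance `2 σ_p² = s_p² + s_{p+1}²`. -/
def σ (P p : ℕ) : ℝ := Real.sqrt ((S.s P p ^ 2 + S.s P (p + 1) ^ 2) / 2)

/-- The swap attempt of chains `p` and `p + 1` at iteration `k` is accepted. -/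
def Accepts (P k p : ℕ) (ω : Ω) : Prop :=
  S.u P k p ω < swapFn (S.τ P p) (S.τ P (p + 1)) (S.σ P p) (S.E P k p ω) (S.E P k (p + 1) ω)

/-- The rejection rate of the pair `(p, p + 1)` for a single attempt (under stationarity the
iteration is irrelevant). -/
def rejectionRate (P p : ℕ) : ℝ := Pr.real {ω | ¬ S.Accepts P 0 p ω}

/-- In the generalized even-odd scheme, the pairs `(1, 2), (3, 4), …` are active in the windows
with even number `t`, the pairs `(2, 3), (4, 5), …` in those with odd number. -/
def Active (t p : ℕ) : Prop := t % 2 = 0 ↔ p % 2 = 1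

/-- The pair `(p, p + 1)`, if active, is swapped in the `t`-th window of `W` iterations. At most
one swap per window is allowed, so this happens iff one of its `W` attempts is accepted. -/
def WindowSwap (P W t p : ℕ) (ω : Ω) : Prop :=
  ∃ k, t * W ≤ k ∧ k < (t + 1) * W ∧ S.Accepts P k p ω

open Classical in
/-- The index process: the chain occupied after `t` windows by the particle that starts at
chain `1`. -/
def index (P W : ℕ) (ω : Ω) : ℕ → ℕ
  | 0 => 1
  | t + 1 =>
    let z := index P W ω t
    if Active t z then
      if z < P ∧ S.WindowSwap P W t z ω then z + 1 else z
    else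
      if 1 < z ∧ S.WindowSwap P W t (z - 1) ω then z - 1 else z

/-- The round trip time, in iterations: `W` times the number of windows until the particle,
started at chain `1` in upward direction, has first been at chain `P` in downward direction and
then is again at chain `1` in upward direction. The direction of a particle at chain `z` in
window `t` is upward iff the pair `(z, z + 1)` has the parity active in that window. -/
def roundTripTime (P W : ℕ) (ω : Ω) : ENNReal :=
  ⨅ (t : ℕ) (_ : (S.index P W ω t = 1 ∧ Active t 1) ∧
      ∃ t' ≤ t, S.index P W ω t' = P ∧ ¬ Active t' P), ((W * t : ℕ) : ENNReal)

/-- Expected round trip time. -/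
def expectedRoundTrip (P W : ℕ) : ENNReal := ∫⁻ ω, S.roundTripTime P W ω ∂Pr

/-- The window size minimises the expected round trip time. -/
def IsOptimalWindow (P W : ℕ) : Prop :=
  1 ≤ W ∧ ∀ W', 1 ≤ W' → S.expectedRoundTrip Pr P W ≤ S.expectedRoundTrip Pr P W'

/-- The explicit (approximately) optimal window size
`⌈(log P + log log P) / (-log r)⌉`, a positive integer. -/
def optWindow (P : ℕ) : ℕ :=
  max 1 ⌈(Real.log P + Real.log (Real.log P)) / (-Real.log (S.rejectionRate Pr P 1))⌉₊

/-- Standing conventions: an energy function whose Gibbs distributions exist, and increasing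
temperature ladders with the given ends. -/
structure Standing : Prop where
  measurable_U : Measurable S.U
  τmin_pos : 0 < S.τmin
  τmin_lt_τmax : S.τmin < S.τmax
  integrable_min : Integrable (fun x => Real.exp (-S.U x / S.τmin)) volume
  integrable_max : Integrable (fun x => Real.exp (-S.U x / S.τmax)) volume
  τ_first : ∀ P, 2 ≤ P → S.τ P 1 = S.τmin
  τ_last : ∀ P, 2 ≤ P → S.τ P P = S.τmax
  τ_lt : ∀ P, 2 ≤ P → ∀ p ∈ Finset.Icc 1 (P - 1), S.τ P p < S.τ P (p + 1)

/-- (B1) Stationarity. -/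
def Stationarity : Prop :=
  ∀ P, 2 ≤ P → ∀ k, ∀ p ∈ Finset.Icc 1 P,
    AEMeasurable (S.β P k p) Pr ∧ Pr.map (S.β P k p) = gibbs S.U (S.τ P p)

/-- The sources of randomness of a swap attempt: the energy of a chain, the error of its
estimate, the uniform decision variable. -/
def source (P k p : ℕ) : Fin 3 → Ω → ℝ
  | 0 => fun ω => S.U (S.β P k p ω)
  | 1 => fun ω => S.E P k p ω - S.U (S.β P k p ω)
  | 2 => S.u P k p

/-- (B2) Weak independence: the energies (not the states) of the chains are independent from
one iteration to the next and from one chain to another, and so are the estimation errors and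
the uniform variables deciding the swaps. -/
def WeakIndependence : Prop :=
  ∀ P, 2 ≤ P →
    (∀ k, ∀ p ∈ Finset.Icc 1 P,
      AEMeasurable (S.u P k p) Pr ∧
        Pr.map (S.u P k p) = (volume : Measure ℝ).restrict (Set.Icc 0 1)) ∧
    iIndepFun (fun i : ℕ × Finset.Icc 1 P × Fin 3 => S.source P i.1 i.2.1 i.2.2) Pr

/-- (B3) Integrability of `U ^ 3` at the lowest and the highest temperature. -/
def Integrability : Prop :=
  Integrable (fun x => S.U x ^ 3) (gibbs S.U S.τmin) ∧
    Integrable (fun x => S.U x ^ 3) (gibbs S.U S.τmax)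

/-- (B4) Approximate geometric spacing:
`τ_{p+1} / τ_p = (τ_P / τ_1) ^ (1 / (P - 1)) + o (1 / P)`, uniformly in `p`. -/
def ApproxGeometric : Prop :=
  ∀ ε : ℝ, 0 < ε → ∀ᶠ P : ℕ in atTop, ∀ p ∈ Finset.Icc 1 (P - 1),
    |S.τ P (p + 1) / S.τ P p - (S.τmax / S.τmin) ^ (1 / ((P : ℝ) - 1))| ≤ ε / P

/-- (C1) Energy normality: the estimation error of chain `p` is centred normal with a standard
deviation `s_p` that does not depend on the state or the iteration. A standard deviation that is
fixed as the number of chains varies is in particular bounded by a multiple of `P`. -/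
def EnergyNormality : Prop :=
  (∀ P, 2 ≤ P → ∀ k, ∀ p ∈ Finset.Icc 1 P,
    AEMeasurable (S.E P k p) Pr ∧
      Pr.map (fun ω => S.E P k p ω - S.U (S.β P k p ω)) =
        gaussianReal 0 (Real.toNNReal (S.s P p ^ 2))) ∧
  (∀ P, 2 ≤ P → ∀ p ∈ Finset.Icc 1 P, 0 ≤ S.s P p) ∧
  ∃ B : ℝ, ∀ P, 2 ≤ P → ∀ p ∈ Finset.Icc 1 P, S.s P p ≤ B * P

/-- Equi-acceptance: all pairs of neighbouring chains have the same rejection rate. -/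
def EquiAcceptance : Prop :=
  ∀ P, 2 ≤ P → ∀ p ∈ Finset.Icc 1 (P - 1), S.rejectionRate Pr P p = S.rejectionRate Pr P 1

/-- `μ_p = (σ_p / τ_{p+1}) log (τ_P / τ_1) / (2 √2)`. -/
def μ (P p : ℕ) : ℝ :=
  S.σ P p / S.τ P (p + 1) * Real.log (S.τmax / S.τmin) / (2 * Real.sqrt 2)

end System

/-- The order of the round trip time, `x log x exp (m² / x²)`. -/
def order (m x : ℝ) : ℝ := x * Real.log x * Real.exp (m ^ 2 / x ^ 2)

/-- `x` minimises the order of the round trip time, the number of chains being treated as a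
continuous variable `≥ 4`. -/
def IsOptimalReal (m x : ℝ) : Prop := 4 ≤ x ∧ ∀ y : ℝ, 4 ≤ y → order m x ≤ order m y

/-- `n` minimises the order of the round trip time among the integers `≥ 4`. -/
def IsOptimalNat (m : ℝ) (n : ℕ) : Prop := 4 ≤ n ∧ ∀ k : ℕ, 4 ≤ k → order m n ≤ order m k

/-- The minimum of `f p` over the `P - 1` pairs `p = 1, …, P - 1` of neighbouring chains
(`P ≥ 2`). -/
def minPairs (P : ℕ) (f : ℕ → ℝ) : ℝ := ⨅ p : Finset.Icc 1 (P - 1), f p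

end PT

end

/-! Since `exp (μ_p² / P²) ≥ 1`, conclusion 1 follows from a bound `C P log P` on the mean round
trip time. That bound rests on three facts. (a) Rejection rates are at most `1 - a` with `a > 0`
independent of `P` (`exists_rejectionRate_le`). The spacing of inverse temperatures is `O(1/P)` and
`σ_p = O(P)`, so their product stays bounded. The energies of both chains lie in a fixed interval
with probability bounded below, and each noise has the favourable sign with probability at least
`1/2`. On this event the swap function is bounded below. (b) Hence the explicit window has size `W =
O(log P)`, while an active pair fails in a whole window with probability `ρ = r^W ≤ 1/(P log P)`.
(c) The distance of the particle from the end of its round trip is a countdown on `0, …, 3P`. Each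
window lowers it unless a swap fails, which has probability at most `ρ` whatever happened before. A
drift argument bounds the mean number of windows by `3P / (1 - ρ)^(3P) = O(P)`
(`tsum_measure_ne_zero_le`, `lintegral_iInf_returns_le`). A window minimising the mean can only do
better. For the optimal number of chains, the derivative of `order m` has the sign of `x² + x²/log x
- 2m²`, which is strictly increasing; this gives uniqueness. The lower bounds use only `order m x ≤
order m (x + 1)`, true of real and integer minimisers alike. It forces `x² > 0.92 m²`
(`sq_lt_of_order_le`), and `0.92 · 9/8 > 1.01²` leaves room to exchange `τ^(p+1)` for `τ^(p)` when
`P` is large. -/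

namespace PT

/-! ### Minimisers of the order `x log x exp (m² / x²)`. -/

lemma one_lt_log_four : (1.386 : ℝ) < Real.log 4 := by
  have h : Real.log 4 = 2 * Real.log 2 := by
    rw [show (4 : ℝ) = 2 ^ 2 by norm_num, Real.log_pow]; norm_num
  have := Real.log_two_gt_d9
  rw [h]; linarith

lemma log_gt_of_four_le {x : ℝ} (hx : 4 ≤ x) : (1.386 : ℝ) < Real.log x :=
  one_lt_log_four.trans_le (Real.log_le_log (by norm_num) hx)

lemma order_pos (m : ℝ) {x : ℝ} (hx : 4 ≤ x) : 0 < order m x := by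
  have := log_gt_of_four_le hx
  unfold order
  have : 0 < Real.log x := by linarith
  positivity

/-- A point where the order does not decrease over the next unit step exceeds `m` up to an
explicit factor. -/
lemma sq_lt_of_order_le {m x : ℝ} (hx : 4 ≤ x) (h : order m x ≤ order m (x + 1)) :
    0.92 * m ^ 2 < x ^ 2 := by
  have hx0 : 0 < x := by linarith
  have hl := log_gt_of_four_le hx
  have hl0 : 0 < Real.log x := by linarith
  have hl1 : 0 < Real.log (x + 1) := by
    have := log_gt_of_four_le (show 4 ≤ x + 1 by linarith)
    linarith
  have hlog := Real.log_le_log (order_pos m hx) h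
  unfold order at hlog
  rw [Real.log_mul (by positivity) (by positivity), Real.log_mul (by positivity) (by positivity),
    Real.log_mul (by positivity) (by positivity), Real.log_mul (by positivity) (by positivity),
    Real.log_exp, Real.log_exp] at hlog
  set D := Real.log (x + 1) - Real.log x with hD
  have hD0 : 0 < D := sub_pos.2 (Real.log_lt_log hx0 (by linarith))
  -- `D ≤ sinh D`, and `sinh D` is rational in `x` because `exp D = (x + 1) / x`. This is sharper
  -- than `D ≤ 1/x`.
  have hDle : D ≤ (2 * x + 1) / (2 * x * (x + 1)) := by
    have hs := Real.self_le_sinh_iff.2 hD0.le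
    rw [Real.sinh_eq, Real.exp_neg, hD, Real.exp_sub, Real.exp_log hx0,
      Real.exp_log (by linarith : 0 < x + 1)] at hs
    rw [← hD] at hs
    refine hs.trans (le_of_eq ?_)
    field_simp
    ring
  have hll : Real.log (Real.log (x + 1)) - Real.log (Real.log x) ≤ D / Real.log x := by
    rw [← Real.log_div hl1.ne' hl0.ne']
    refine (Real.log_le_sub_one_of_pos (by positivity)).trans (le_of_eq ?_)
    rw [hD]; field_simp
  -- `1 / 1.386 < 0.7216`.
  have hq : D / Real.log x ≤ D * 0.7216 := by
    rw [div_le_iff₀ hl0]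
    nlinarith
  have hm : m ^ 2 / x ^ 2 - m ^ 2 / (x + 1) ^ 2 ≤ 1.7216 * ((2 * x + 1) / (2 * x * (x + 1))) := by
    linarith
  have hm2 : m ^ 2 / x ^ 2 - m ^ 2 / (x + 1) ^ 2
      = (m ^ 2 / (x * (x + 1))) * ((2 * x + 1) / (x * (x + 1))) := by
    field_simp
    ring
  have hm3 : 1.7216 * ((2 * x + 1) / (2 * x * (x + 1)))
      = 0.8608 * ((2 * x + 1) / (x * (x + 1))) := by
    field_simp
    norm_num
  rw [hm2, hm3] at hm
  have hm4 := le_of_mul_le_mul_right hm (by positivity)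
  rw [div_le_iff₀ (by positivity)] at hm4
  -- Now `m² ≤ 0.8608 x (x + 1)`, and `x + 1 ≤ 5x/4` because `x ≥ 4`; finally `0.92 · 0.8608 · 1.25
  -- < 1`.
  nlinarith

/-- The derivative is factored so that its sign is that of the last bracket. -/
lemma hasDerivAt_order (m : ℝ) {x : ℝ} (hx : 4 ≤ x) :
    HasDerivAt (order m)
      (Real.exp (m ^ 2 / x ^ 2) * Real.log x / x ^ 2 * (x ^ 2 + x * (x / Real.log x) - 2 * m ^ 2))
      x := by
  have hl := log_gt_of_four_le hx
  have hl0 : Real.log x ≠ 0 := by linarith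
  have hx0 : x ≠ 0 := by linarith
  have h1 := (hasDerivAt_id x).mul (Real.hasDerivAt_log hx0)
  have h2 := ((hasDerivAt_const x (m ^ 2)).div ((hasDerivAt_id x).pow 2)
    (pow_ne_zero 2 hx0)).exp
  refine (h1.mul h2).congr_deriv ?_
  simp only [id, Pi.mul_apply, Pi.div_apply, Pi.pow_apply]
  field_simp
  ring

lemma continuousOn_order (m : ℝ) : ContinuousOn (order m) (Set.Ici 4) :=
  fun _ hx => (hasDerivAt_order m hx).continuousAt.continuousWithinAt

/-- `x / log x` is nondecreasing from `e` on, so the bracket in the derivative changes sign at most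
once. -/
lemma strictMonoOn_critical :
    StrictMonoOn (fun x : ℝ => x ^ 2 + x * (x / Real.log x)) (Set.Ici 4) := by
  intro x hx y hy hxy
  simp only [Set.mem_Ici] at hx hy
  have hlx := log_gt_of_four_le hx
  have hly := log_gt_of_four_le hy
  have he : Real.exp 1 ≤ x := by linarith [Real.exp_one_lt_d9]
  have h := Real.log_div_self_antitoneOn he (he.trans hxy.le) hxy.le
  simp only at h
  have h2 : x / Real.log x ≤ y / Real.log y := by
    rw [div_le_div_iff₀ (by linarith) (by linarith)] at h ⊢
    linarith
  have h3 : 0 < x / Real.log x := div_pos (by linarith) (by linarith)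
  simp only
  nlinarith

/-- Coercivity: it confines the search for a minimiser to a compact interval, or to a finite set of
integers. -/
lemma self_le_order (m : ℝ) {x : ℝ} (hx : 4 ≤ x) : x ≤ order m x := by
  have hl := log_gt_of_four_le hx
  have h1 : 1 ≤ Real.exp (m ^ 2 / x ^ 2) := Real.one_le_exp (by positivity)
  unfold order
  have h2 : x ≤ x * Real.log x := by nlinarith
  nlinarith

lemma exists_isOptimalReal (m : ℝ) : ∃ x, IsOptimalReal m x := by
  obtain ⟨x, hx, hmin⟩ := (isCompact_Icc (a := (4 : ℝ)) (b := max 4 (order m 4))).exists_isMinOn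
    ⟨4, by simp⟩ ((continuousOn_order m).mono Set.Icc_subset_Ici_self)
  refine ⟨x, hx.1, fun y hy => ?_⟩
  by_cases h : y ≤ max 4 (order m 4)
  · exact hmin ⟨hy, h⟩
  · have h4 : order m x ≤ order m 4 := hmin (by simp)
    have := self_le_order m hy
    have := le_max_right 4 (order m 4)
    linarith

/-- Between two minimisers Rolle's theorem yields a critical point `c`. Beyond `c` the derivative is
positive, so the value at `c` is below that at the larger minimiser. -/
lemma IsOptimalReal.not_lt {m x y : ℝ} (hx : IsOptimalReal m x) (hy : IsOptimalReal m y) :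
    ¬ x < y := by
  intro hxy
  have heq : order m x = order m y := le_antisymm (hx.2 y hy.1) (hy.2 x hx.1)
  obtain ⟨c, hc, hc0⟩ := exists_hasDerivAt_eq_zero hxy
    ((continuousOn_order m).mono (fun z hz => hx.1.trans hz.1)) heq
    (fun z hz => hasDerivAt_order m (hx.1.trans hz.1.le))
  have hc4 : 4 ≤ c := hx.1.trans hc.1.le
  have hlc := log_gt_of_four_le hc4
  have hlc0 : 0 < Real.log c := by linarith
  have hc' : c ^ 2 + c * (c / Real.log c) - 2 * m ^ 2 = 0 := by
    refine (mul_eq_zero.1 hc0).resolve_left ?_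
    positivity
  have hmono : StrictMonoOn (order m) (Set.Icc c y) := by
    refine strictMonoOn_of_deriv_pos (convex_Icc c y)
      ((continuousOn_order m).mono (fun z hz => hc4.trans hz.1)) fun z hz => ?_
    rw [interior_Icc] at hz
    have hz4 : 4 ≤ z := hc4.trans hz.1.le
    rw [(hasDerivAt_order m hz4).deriv]
    have hlz := log_gt_of_four_le hz4
    have hlz0 : 0 < Real.log z := by linarith
    have h1 := strictMonoOn_critical (Set.mem_Ici.2 hc4) (Set.mem_Ici.2 hz4) hz.1
    simp only at h1
    have h2 : 0 < z ^ 2 + z * (z / Real.log z) - 2 * m ^ 2 := by linarith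
    positivity
  have h1 := hmono (Set.left_mem_Icc.2 hc.2.le) (Set.right_mem_Icc.2 hc.2.le) hc.2
  exact absurd (hy.2 c hc4) (not_le.2 h1)

lemma existsUnique_isOptimalReal (m : ℝ) : ∃! x, IsOptimalReal m x := by
  obtain ⟨x, hx⟩ := exists_isOptimalReal m
  exact ⟨x, hx, fun y hy => le_antisymm (not_lt.1 (hx.not_lt hy)) (not_lt.1 (hy.not_lt hx))⟩

lemma exists_isOptimalNat (m : ℝ) : ∃ n, IsOptimalNat m n := by
  obtain ⟨n, hn, hmin⟩ := Finset.exists_min_image (Finset.Icc 4 (max 4 ⌈order m 4⌉₊))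
    (fun n : ℕ => order m n) ⟨4, by simp⟩
  refine ⟨n, (Finset.mem_Icc.1 hn).1, fun k hk => ?_⟩
  by_cases h : k ≤ max 4 ⌈order m 4⌉₊
  · exact hmin k (Finset.mem_Icc.2 ⟨hk, h⟩)
  · have h4 := hmin 4 (by simp)
    have hk' : (4 : ℝ) ≤ k := by exact_mod_cast hk
    have h1 := self_le_order m hk'
    have h2 : order m 4 ≤ k := (Nat.le_ceil _).trans
      (by exact_mod_cast (le_max_right _ _).trans (not_le.1 h).le)
    push_cast at h4
    linarith

lemma sq_lt_of_isOptimal {m x : ℝ}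
    (h : IsOptimalReal m x ∨ ∃ n : ℕ, x = n ∧ IsOptimalNat m n) :
    4 ≤ x ∧ 0.92 * m ^ 2 < x ^ 2 := by
  rcases h with h | ⟨n, rfl, h⟩
  · exact ⟨h.1, sq_lt_of_order_le h.1 (h.2 _ (by linarith [h.1]))⟩
  · have h4 : (4 : ℝ) ≤ n := by exact_mod_cast h.1
    exact ⟨h4, sq_lt_of_order_le h4 (by exact_mod_cast h.2 (n + 1) (by linarith [h.1]))⟩

lemma minPairs_le {P q : ℕ} (f : ℕ → ℝ) (hq : q ∈ Finset.Icc 1 (P - 1)) :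
    minPairs P f ≤ f q :=
  ciInf_le (Set.finite_range fun p : Finset.Icc 1 (P - 1) => f p).bddBelow ⟨q, hq⟩


/-! ### A drift bound for countdowns with failures. -/

/-- The expected time to count down from `m` to `0` is at most `driftBound q M m`, if every step
succeeds with probability at least `q` and a failure leads to a state `≤ M`. -/
noncomputable def driftBound (q : ℝ) (M m : ℕ) : ℝ := (∑ i ∈ Finset.range m, q ^ i) / q ^ M

lemma driftBound_zero (q : ℝ) (M : ℕ) : driftBound q M 0 = 0 := by simp [driftBound]

lemma driftBound_mono {q : ℝ} (hq : 0 < q) (M : ℕ) : Monotone (driftBound q M) := by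
  intro a b hab
  unfold driftBound
  gcongr

lemma driftBound_nonneg {q : ℝ} (hq : 0 < q) (M m : ℕ) : 0 ≤ driftBound q M m := by
  rw [← driftBound_zero q M]
  exact driftBound_mono hq M (Nat.zero_le m)

/-- The Poisson equation of the worst case, in which every failure leads back to `M`. The
normalisation `1 / q ^ M` is what makes it hold, since `(1 - q) f(M) = q⁻ᴹ - 1`. -/
lemma driftBound_succ {q : ℝ} (hq : 0 < q) (M m : ℕ) :
    q * driftBound q M m + (1 - q) * driftBound q M M = driftBound q M (m + 1) - 1 := by
  unfold driftBound
  have h := mul_neg_geom_sum q M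
  have h2 := geom_sum_succ (x := q) (n := m)
  have hqM : q ^ M ≠ 0 := (pow_pos hq M).ne'
  rw [h2]
  field_simp
  linarith

lemma driftBound_self_le {q : ℝ} (hq : 0 < q) (hq1 : q ≤ 1) (M : ℕ) :
    driftBound q M M ≤ M / q ^ M := by
  unfold driftBound
  gcongr
  calc ∑ i ∈ Finset.range M, q ^ i ≤ ∑ _i ∈ Finset.range M, (1 : ℝ) :=
        Finset.sum_le_sum fun i _ => pow_le_one₀ hq.le hq1
    _ = M := by simp

lemma sum_indicator_eq {Ω : Type*} {M : ℕ} {Y : Ω → ℕ} (hM : ∀ ω, Y ω ≤ M) (f : ℕ → ℝ)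
    (hf : f 0 = 0) (ω : Ω) :
    f (Y ω) = ∑ m ∈ Finset.range M, {ω | Y ω = m + 1}.indicator (fun _ => f (m + 1)) ω := by
  rcases h : Y ω with _ | n
  · rw [hf, Finset.sum_eq_zero]
    intro m _
    simp [Set.indicator, h]
  · rw [Finset.sum_eq_single n]
    · simp [Set.indicator, h]
    · intro m _ hm
      simp [Set.indicator, h, Ne.symm hm]
    · intro hn
      have := hM ω
      simp at hn
      omega

section Drift

variable {Ω : Type*} [MeasurableSpace Ω] {Pr : Measure Ω} [IsProbabilityMeasure Pr]
  {X : ℕ → Ω → ℕ} {F : ℕ → Set Ω} {M : ℕ} {q : ℝ}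

lemma integrable_comp_of_measurable_nat {Y : Ω → ℕ} (hY : Measurable Y) (hM : ∀ ω, Y ω ≤ M)
    (f : ℕ → ℝ) : Integrable (fun ω => f (Y ω)) Pr := by
  refine Integrable.of_bound (C := ∑ m ∈ Finset.range (M + 1), |f m|)
    ((measurable_from_nat (f := f)).comp hY).aestronglyMeasurable
    (Eventually.of_forall fun ω => ?_)
  exact Finset.single_le_sum (f := fun m => |f m|) (fun _ _ => abs_nonneg _)
    (Finset.mem_range.2 (Nat.lt_succ_of_le (hM ω)))

/-- As long as the countdown runs, the potential loses at least one unit per step in the mean.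
Summation over `t` then bounds the expected duration. -/
lemma integral_drift_le (hX : ∀ t, Measurable (X t)) (hM : ∀ t ω, X t ω ≤ M) (hq : 0 < q)
    (hF : ∀ t, MeasurableSet (F t)) (h0 : ∀ t ω, X t ω = 0 → X (t + 1) ω = 0)
    (hstep : ∀ t ω m, X t ω = m + 1 → ω ∉ F t → X (t + 1) ω ≤ m)
    (hprob : ∀ t m, Pr.real ({ω | X t ω = m + 1} ∩ F t) ≤ (1 - q) * Pr.real {ω | X t ω = m + 1})
    (t : ℕ) :
    ∫ ω, driftBound q M (X (t + 1) ω) ∂Pr + Pr.real {ω | X t ω ≠ 0} ≤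
      ∫ ω, driftBound q M (X t ω) ∂Pr := by
  set f := driftBound q M with hf
  have hset : ∀ m, MeasurableSet {ω | X t ω = m} := fun m => hX t (measurableSet_singleton m)
  have hint : ∀ (s : Set Ω) (c : ℝ), MeasurableSet s → Integrable (s.indicator fun _ => c) Pr :=
    fun s c hs => (integrable_const c).indicator hs
  -- From state `m + 1` the potential becomes at most `f m` on success and at most `f M` on failure.
  have hpt : ∀ ω, f (X (t + 1) ω) ≤ ∑ m ∈ Finset.range M,
      ({ω | X t ω = m + 1}.indicator (fun _ => f m) ω +
        ({ω | X t ω = m + 1} ∩ F t).indicator (fun _ => f M - f m) ω) := by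
    intro ω
    have hnn : ∀ m ∈ Finset.range M, 0 ≤ ({ω | X t ω = m + 1}.indicator (fun _ => f m) ω +
        ({ω | X t ω = m + 1} ∩ F t).indicator (fun _ => f M - f m) ω) := by
      intro m hm
      have hm' : f m ≤ f M := driftBound_mono hq M (Finset.mem_range.1 hm).le
      exact add_nonneg (Set.indicator_nonneg (fun _ _ => driftBound_nonneg hq M m) ω)
        (Set.indicator_nonneg (fun _ _ => sub_nonneg.2 hm') ω)
    rcases h : X t ω with _ | n
    · rw [h0 t ω h, hf, driftBound_zero]
      exact Finset.sum_nonneg hnn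
    · have hn : n ∈ Finset.range M := by
        have := hM t ω
        simp; omega
      refine le_trans ?_ (Finset.single_le_sum hnn hn)
      by_cases hω : ω ∈ F t
      · simp only [Set.indicator, Set.mem_inter_iff, Set.mem_ofPred_eq, h, hω, and_self, if_true]
        have := driftBound_mono hq M (hM (t + 1) ω)
        linarith
      · simp only [Set.indicator, Set.mem_inter_iff, Set.mem_ofPred_eq, h, hω, and_false, if_true,
          if_false, add_zero]
        exact driftBound_mono hq M (hstep t ω n h hω)
  have h1 : ∫ ω, f (X (t + 1) ω) ∂Pr ≤ ∑ m ∈ Finset.range M,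
      (Pr.real {ω | X t ω = m + 1} * f m +
        Pr.real ({ω | X t ω = m + 1} ∩ F t) * (f M - f m)) := by
    refine (integral_mono (integrable_comp_of_measurable_nat (hX _) (hM _) f)
      (integrable_finsetSum _ fun m _ => (hint _ _ (hset _)).add
        (hint _ _ ((hset _).inter (hF t)))) hpt).trans (le_of_eq ?_)
    rw [integral_finsetSum _ fun m _ => (hint _ _ (hset _)).add
        (hint _ _ ((hset _).inter (hF t)))]
    refine Finset.sum_congr rfl fun m _ => ?_
    rw [integral_add' (hint _ _ (hset _)) (hint _ _ ((hset _).inter (hF t))),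
      integral_indicator_const _ (hset _), integral_indicator_const _ ((hset _).inter (hF t))]
    rfl
  have h2 : ∑ m ∈ Finset.range M, (Pr.real {ω | X t ω = m + 1} * f m +
        Pr.real ({ω | X t ω = m + 1} ∩ F t) * (f M - f m)) ≤
      ∑ m ∈ Finset.range M, Pr.real {ω | X t ω = m + 1} * (f (m + 1) - 1) := by
    refine Finset.sum_le_sum fun m hm => ?_
    have hm' : f m ≤ f M := driftBound_mono hq M (Finset.mem_range.1 hm).le
    have h3 := mul_le_mul_of_nonneg_right (hprob t m) (sub_nonneg.2 hm')
    have h4 := driftBound_succ hq M m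
    rw [← hf] at h4
    rw [← h4]
    linarith
  have h3 : ∑ m ∈ Finset.range M, Pr.real {ω | X t ω = m + 1} * (f (m + 1) - 1) =
      ∫ ω, f (X t ω) ∂Pr - Pr.real {ω | X t ω ≠ 0} := by
    set g : ℕ → ℝ := fun m => f m - if m = 0 then 0 else 1 with hg
    have hg0 : g 0 = 0 := by simp [hg, hf, driftBound_zero]
    have h5 : ∫ ω, g (X t ω) ∂Pr
        = ∑ m ∈ Finset.range M, Pr.real {ω | X t ω = m + 1} * (f (m + 1) - 1) := by
      simp_rw [sum_indicator_eq (hM t) g hg0]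
      rw [integral_finsetSum _ fun m _ => hint _ _ (hset _)]
      refine Finset.sum_congr rfl fun m _ => ?_
      rw [integral_indicator_const _ (hset _)]
      simp [hg]
    rw [← h5]
    have hne : MeasurableSet {ω | X t ω ≠ 0} := (hset 0).compl
    have h6 : ∀ ω, g (X t ω) = f (X t ω) - {ω | X t ω ≠ 0}.indicator (fun _ => (1 : ℝ)) ω := by
      intro ω
      by_cases h : X t ω = 0 <;> simp [hg, Set.indicator, h]
    simp_rw [h6]
    rw [integral_sub (integrable_comp_of_measurable_nat (hX _) (hM _) f) (hint _ _ hne),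
      integral_indicator_const _ hne]
    simp
  linarith

/-- The expected number of steps of a countdown with success probability `q`. -/
lemma tsum_measure_ne_zero_le (hX : ∀ t, Measurable (X t)) (hM : ∀ t ω, X t ω ≤ M) (hq : 0 < q)
    (hq1 : q ≤ 1) (hF : ∀ t, MeasurableSet (F t)) (h0 : ∀ t ω, X t ω = 0 → X (t + 1) ω = 0)
    (hstep : ∀ t ω m, X t ω = m + 1 → ω ∉ F t → X (t + 1) ω ≤ m)
    (hprob : ∀ t m, Pr.real ({ω | X t ω = m + 1} ∩ F t) ≤
      (1 - q) * Pr.real {ω | X t ω = m + 1}) :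
    ∑' t, Pr {ω | X t ω ≠ 0} ≤ ENNReal.ofReal (M / q ^ M) := by
  have hsum : ∀ n, ∑ t ∈ Finset.range n, Pr.real {ω | X t ω ≠ 0} +
      ∫ ω, driftBound q M (X n ω) ∂Pr ≤ ∫ ω, driftBound q M (X 0 ω) ∂Pr := by
    intro n
    induction n with
    | zero => simp
    | succ n ih =>
      rw [Finset.sum_range_succ]
      have := integral_drift_le (Pr := Pr) hX hM hq hF h0 hstep hprob n
      linarith
  have hfin : ∫ ω, driftBound q M (X 0 ω) ∂Pr ≤ M / q ^ M := by
    calc ∫ ω, driftBound q M (X 0 ω) ∂Pr ≤ ∫ _ω, driftBound q M M ∂Pr :=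
          integral_mono (integrable_comp_of_measurable_nat (hX 0) (hM 0) _) (integrable_const _)
            fun ω => driftBound_mono hq M (hM 0 ω)
      _ ≤ M / q ^ M := by simpa using driftBound_self_le hq hq1 M
  refine ENNReal.tsum_le_of_sum_range_le fun n => ?_
  have h1 : ∑ t ∈ Finset.range n, Pr {ω | X t ω ≠ 0} =
      ENNReal.ofReal (∑ t ∈ Finset.range n, Pr.real {ω | X t ω ≠ 0}) := by
    rw [ENNReal.ofReal_sum_of_nonneg fun _ _ => measureReal_nonneg]
    exact Finset.sum_congr rfl fun t _ => by simp
  rw [h1]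
  refine ENNReal.ofReal_le_ofReal ?_
  have h2 : 0 ≤ ∫ ω, driftBound q M (X n ω) ∂Pr :=
    integral_nonneg fun ω => driftBound_nonneg hq M _
  linarith [hsum n]

end Drift

/-- A predicate of finitely many measurable events is measurable. -/
lemma measurableSet_of_dependsOn {Ω ι : Type*} [MeasurableSpace Ω] {b : ι → Ω → Prop}
    (s : Finset ι) (hb : ∀ i ∈ s, MeasurableSet {ω | b i ω}) {Φ : (ι → Prop) → Prop}
    (hΦ : DependsOn Φ (s : Set ι)) : MeasurableSet {ω | Φ fun i => b i ω} := by
  classical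
  let g : Ω → (s → Prop) := fun ω i => b i ω
  have hg : Measurable g := measurable_pi_iff.2 fun i => measurableSet_setOfPred.1 (hb i i.2)
  -- `Φ` factors through the finite cube of truth values on `s`, all of whose subsets are
  -- measurable; coordinates outside `s` are set to `False`.
  have : {ω | Φ fun i => b i ω} = g ⁻¹' {v | Φ fun i => ∃ h : i ∈ s, v ⟨i, h⟩} := by
    ext ω
    simp only [Set.mem_ofPred_eq, Set.mem_preimage, g]
    rw [hΦ]
    intro i hi
    have hi : i ∈ s := hi
    simp [hi]
  rw [this]
  exact hg (Set.toFinite _).measurableSet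


/-! ### The particle as a deterministic function of the successful swaps. -/

open PT.System (Active)

section Walk

open Classical in
/-- The chain occupied after `t` windows by a particle that starts at chain `1`, if `b (t, p)`
says whether the pair `(p, p + 1)` can be swapped in window `t`. -/
noncomputable def walk (P : ℕ) (b : ℕ × ℕ → Prop) : ℕ → ℕ
  | 0 => 1
  | t + 1 =>
    let z := walk P b t
    if Active t z then
      if z < P ∧ b (t, z) then z + 1 else z
    else
      if 1 < z ∧ b (t, z - 1) then z - 1 else z

/-- The walk has been at chain `P` in downward direction. -/
def Turned (P : ℕ) (b : ℕ × ℕ → Prop) (t : ℕ) : Prop :=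
  ∃ t' ≤ t, walk P b t' = P ∧ ¬ Active t' P

/-- A round trip ends after exactly `t` windows. -/
def Returns (P : ℕ) (b : ℕ × ℕ → Prop) (t : ℕ) : Prop :=
  (walk P b t = 1 ∧ Active t 1) ∧ Turned P b t

/-- A round trip has been completed within `t` windows. -/
def Completed (P : ℕ) (b : ℕ × ℕ → Prop) (t : ℕ) : Prop := ∃ t' ≤ t, Returns P b t'

open Classical in
/-- The number of windows to the end of the round trip, if no swap fails. -/
noncomputable def remaining (P : ℕ) (b : ℕ × ℕ → Prop) (t : ℕ) : ℕ :=
  if Completed P b t then 0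
  else if Active t (walk P b t) then 2 * P + 1 - walk P b t
  else if Turned P b t then walk P b t
  else walk P b t + 2 * P

open Classical in
/-- The lower chain of the pair whose swap would move the particle onwards. -/
noncomputable def pairAt (t z : ℕ) : ℕ := if Active t z then z else z - 1

/-- The pairs of neighbouring chains in the first `t` windows. -/
def pastPairs (P t : ℕ) : Finset (ℕ × ℕ) := Finset.range t ×ˢ Finset.Icc 1 (P - 1)

lemma mem_pastPairs {P t : ℕ} {i : ℕ × ℕ} :
    i ∈ pastPairs P t ↔ i.1 < t ∧ 1 ≤ i.2 ∧ i.2 ≤ P - 1 := by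
  simp [pastPairs]

lemma pastPairs_mono {P s t : ℕ} (h : s ≤ t) : pastPairs P s ⊆ pastPairs P t := by
  intro i
  simp only [mem_pastPairs]
  omega

variable {P : ℕ} {b b' : ℕ × ℕ → Prop} {t : ℕ}

lemma one_le_walk : 1 ≤ walk P b t := by
  induction t with
  | zero => simp [walk]
  | succ t ih =>
    simp only [walk]
    split_ifs <;> omega

lemma walk_le (hP : 1 ≤ P) : walk P b t ≤ P := by
  induction t with
  | zero => simpa [walk] using hP
  | succ t ih =>
    simp only [walk]
    split_ifs <;> omega

/-- Adaptedness: the position at window `t` is determined by earlier windows, hence is independent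
of the swaps in window `t` itself. -/
lemma walk_congr (hP : 1 ≤ P) (h : ∀ i ∈ pastPairs P t, b i = b' i) : walk P b t = walk P b' t := by
  classical
  induction t with
  | zero => rfl
  | succ t ih =>
    have ih := ih fun i hi => h i (pastPairs_mono (Nat.le_succ t) hi)
    have h1 : 1 ≤ walk P b' t := one_le_walk
    have h2 : walk P b' t ≤ P := walk_le hP
    simp only [walk, ih]
    have hu : (walk P b' t < P ∧ b (t, walk P b' t)) = (walk P b' t < P ∧ b' (t, walk P b' t)) := by
      by_cases hz : walk P b' t < P
      · rw [h _ (mem_pastPairs.2 ⟨Nat.lt_succ_self t, h1, by dsimp only; omega⟩)]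
      · simp [hz]
    have hd : (1 < walk P b' t ∧ b (t, walk P b' t - 1)) =
        (1 < walk P b' t ∧ b' (t, walk P b' t - 1)) := by
      by_cases hz : 1 < walk P b' t
      · rw [h _ (mem_pastPairs.2 ⟨Nat.lt_succ_self t, by dsimp only; omega, by dsimp only; omega⟩)]
      · simp [hz]
    simp only [hu, hd]

lemma turned_congr (hP : 1 ≤ P) (h : ∀ i ∈ pastPairs P t, b i = b' i) :
    Turned P b t = Turned P b' t := by
  unfold Turned
  refine propext (exists_congr fun s => and_congr_right fun hs => ?_)
  rw [walk_congr hP fun i hi => h i (pastPairs_mono hs hi)]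

lemma returns_congr (hP : 1 ≤ P) (h : ∀ i ∈ pastPairs P t, b i = b' i) : Returns P b t = Returns P b' t := by
  unfold Returns
  rw [walk_congr hP h, turned_congr hP h]

lemma completed_congr (hP : 1 ≤ P) (h : ∀ i ∈ pastPairs P t, b i = b' i) :
    Completed P b t = Completed P b' t := by
  unfold Completed Returns
  refine propext (exists_congr fun s => and_congr_right fun hs => ?_)
  rw [walk_congr hP fun i hi => h i (pastPairs_mono hs hi),
    turned_congr hP fun i hi => h i (pastPairs_mono hs hi)]

lemma remaining_congr (hP : 1 ≤ P) (h : ∀ i ∈ pastPairs P t, b i = b' i) :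
    remaining P b t = remaining P b' t := by
  classical
  unfold remaining
  simp only [walk_congr hP h, turned_congr hP h, completed_congr hP h]

/-- The largest value, `3P`, belongs to a particle that goes down from chain `P` before having
turned: `P` windows to chain `1` facing up, then a full round trip of `2P`. -/
lemma remaining_le (hP : 1 ≤ P) : remaining P b t ≤ 3 * P := by
  have h1 : 1 ≤ walk P b t := one_le_walk
  have h2 : walk P b t ≤ P := walk_le hP
  unfold remaining
  split_ifs <;> omega

lemma remaining_eq_zero_iff (hP : 1 ≤ P) : remaining P b t = 0 ↔ Completed P b t := by
  have h1 : 1 ≤ walk P b t := one_le_walk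
  have h2 : walk P b t ≤ P := walk_le hP
  unfold remaining
  split_ifs with h <;> simp only [h, iff_false] <;> omega

lemma Completed.mono {s : ℕ} (h : Completed P b t) (hs : t ≤ s) : Completed P b s :=
  let ⟨t', ht', h'⟩ := h
  ⟨t', ht'.trans hs, h'⟩

lemma Turned.mono {s : ℕ} (h : Turned P b t) (hs : t ≤ s) : Turned P b s :=
  let ⟨t', ht', h'⟩ := h
  ⟨t', ht'.trans hs, h'⟩

lemma active_succ_succ {t z : ℕ} : Active (t + 1) (z + 1) ↔ Active t z := by
  unfold Active; omega

lemma active_succ_left {t z : ℕ} : Active (t + 1) z ↔ ¬ Active t z := by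
  unfold Active; omega

/-- Unless the swap that would move the particle onwards fails, it gets one step closer to the
end of the round trip. -/
lemma remaining_succ_le (hP : 2 ≤ P) {m : ℕ} (hm : remaining P b t = m + 1)
    (hb : pairAt t (walk P b t) ∈ Finset.Icc 1 (P - 1) → b (t, pairAt t (walk P b t))) :
    remaining P b (t + 1) ≤ m := by
  have h1 : 1 ≤ walk P b t := one_le_walk
  have h2 : walk P b t ≤ P := walk_le (by omega)
  have hc : ¬ Completed P b t := by
    rw [← remaining_eq_zero_iff (by omega)]
    omega
  by_cases hc' : Completed P b (t + 1)
  · rw [(remaining_eq_zero_iff (by omega)).2 hc']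
    exact Nat.zero_le m
  by_cases ha : Active t (walk P b t)
  -- At chain `P` facing up no swap is needed: the particle stays, and the parity change alone turns
  -- it downward. Chain `1` facing down is analogous.
  · rcases h2.lt_or_eq with hz | hz
    · have hb := hb (by simp [pairAt, ha]; omega)
      simp only [pairAt, ha, if_true] at hb
      have hw : walk P b (t + 1) = walk P b t + 1 := by simp [walk, ha, hz, hb]
      have ha' : Active (t + 1) (walk P b (t + 1)) := by rwa [hw, active_succ_succ]
      simp only [remaining, hc, hc', ha, ha', if_true, if_false] at hm ⊢
      omega
    · have hw : walk P b (t + 1) = P := by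
        simp [walk, hz]
        intro h
        exact absurd ha (by rwa [hz])
      have ha' : ¬ Active (t + 1) P := by rwa [active_succ_left, not_not, ← hz]
      have ht : Turned P b (t + 1) := ⟨t + 1, le_rfl, hw, ha'⟩
      rw [← hw] at ha'
      simp only [remaining, hc, hc', ha, ha', ht, if_true, if_false] at hm ⊢
      omega
  · rcases h1.lt_or_eq with hz | hz
    · have hb := hb (by simp [pairAt, ha]; omega)
      simp only [pairAt, ha, if_false] at hb
      have hw : walk P b (t + 1) = walk P b t - 1 := by simp [walk, ha, hz, hb]
      have ha' : ¬ Active (t + 1) (walk P b (t + 1)) := by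
        rw [hw]
        obtain ⟨y, hy⟩ : ∃ y, walk P b t = y + 1 := ⟨walk P b t - 1, by omega⟩
        rw [hy, Nat.add_sub_cancel, active_succ_left, not_not]
        rw [hy] at ha
        unfold Active at ha ⊢
        omega
      have hmono : Turned P b t → Turned P b (t + 1) := fun h => h.mono (Nat.le_succ t)
      simp only [remaining, hc, hc', ha, ha', if_false] at hm ⊢
      split_ifs at hm ⊢ <;> first | omega | (exfalso; tauto)
    · have hw : walk P b (t + 1) = 1 := by
        simp [walk, ← hz]
        intro h
        exact absurd h (by rwa [← hz] at ha)
      have ha' : Active (t + 1) 1 := by rwa [active_succ_left, hz]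
      have ht : ¬ Turned P b t := fun h =>
        hc' ⟨t + 1, le_rfl, ⟨hw, ha'⟩, h.mono (Nat.le_succ t)⟩
      have ha'' : Active (t + 1) (walk P b (t + 1)) := by rwa [hw]
      simp only [remaining, hc, hc', ha, ha'', ht, if_true, if_false] at hm ⊢
      omega

/-- The round trip time is at most the time spent in windows before its completion. -/
lemma iInf_returns_le (hP : 1 ≤ P) {W : ℕ} (hW : 1 ≤ W) :
    ⨅ (t : ℕ) (_ : Returns P b t), ((W * t : ℕ) : ENNReal) ≤
      W * ∑' t, {t | remaining P b t ≠ 0}.indicator 1 t := by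
  classical
  by_cases h : ∃ t, Returns P b t
  · refine (iInf₂_le (Nat.find h) (Nat.find_spec h)).trans ?_
    push_cast
    gcongr
    refine le_trans (le_of_eq ?_) (ENNReal.sum_le_tsum (Finset.range (Nat.find h)))
    rw [Finset.sum_congr rfl (g := fun _ => 1), Finset.sum_const, Finset.card_range, nsmul_one]
    intro t ht
    have hne : remaining P b t ≠ 0 := by
      rw [Ne, remaining_eq_zero_iff hP]
      rintro ⟨s, hs, hr⟩
      exact Nat.find_min h (lt_of_le_of_lt hs (Finset.mem_range.1 ht)) hr
    simp [Set.indicator, hne]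
  · have hne : ∀ t, remaining P b t ≠ 0 := by
      intro t
      rw [Ne, remaining_eq_zero_iff hP]
      rintro ⟨s, _, hr⟩
      exact h ⟨s, hr⟩
    -- Without a return the infimum is over the empty set, hence infinite; so is the sum.
    have : ∑' t, {t | remaining P b t ≠ 0}.indicator (1 : ℕ → ENNReal) t = ⊤ := by
      simp only [Set.indicator, Set.mem_ofPred_eq, hne, not_false_eq_true, if_true, Pi.one_apply,
        ne_eq]
      exact ENNReal.tsum_const_eq_top_of_ne_zero one_ne_zero
    rw [this, ENNReal.mul_top (by exact_mod_cast (by omega : W ≠ 0))]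
    exact le_top

end Walk

/-- The mean round trip time of a particle that is moved onwards with probability at least `q`,
whatever happened before. -/
theorem lintegral_iInf_returns_le {Ω : Type*} [MeasurableSpace Ω] {Pr : Measure Ω}
    [IsProbabilityMeasure Pr] {P W : ℕ} (hP : 2 ≤ P) (hW : 1 ≤ W) {B : ℕ × ℕ → Ω → Prop} {q : ℝ}
    (hq : 0 < q) (hq1 : q ≤ 1)
    (hB : ∀ t, ∀ p ∈ Finset.Icc 1 (P - 1), MeasurableSet {ω | B (t, p) ω})
    (hind : ∀ t, ∀ p ∈ Finset.Icc 1 (P - 1), ∀ Φ : (ℕ × ℕ → Prop) → Prop,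
      DependsOn Φ (pastPairs P t : Set (ℕ × ℕ)) →
      Pr.real {ω | Φ (fun i => B i ω) ∧ ¬ B (t, p) ω} ≤
        (1 - q) * Pr.real {ω | Φ fun i => B i ω}) :
    ∫⁻ ω, ⨅ (t : ℕ) (_ : Returns P (fun i => B i ω) t), ((W * t : ℕ) : ENNReal) ∂Pr ≤
      W * ENNReal.ofReal ((3 * P : ℕ) / q ^ (3 * P)) := by
  have hP1 : 1 ≤ P := by omega
  have hpast : ∀ t, ∀ Φ : (ℕ × ℕ → Prop) → Prop, DependsOn Φ (pastPairs P t : Set (ℕ × ℕ)) →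
      MeasurableSet {ω | Φ fun i => B i ω} := fun t Φ hΦ =>
    measurableSet_of_dependsOn (pastPairs P t) (fun i hi => hB i.1 i.2
      (Finset.mem_Icc.2 (mem_pastPairs.1 hi).2)) hΦ
  set X : ℕ → Ω → ℕ := fun t ω => remaining P (fun i => B i ω) t
  have hdep : ∀ t m z, DependsOn (fun b => remaining P b t = m ∧ walk P b t = z)
      (pastPairs P t : Set (ℕ × ℕ)) := by
    intro t m z b b' hbb
    have h : ∀ i ∈ pastPairs P t, b i = b' i := fun i hi => hbb i hi
    simp only [remaining_congr hP1 h, walk_congr hP1 h]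
  have hdepX : ∀ t m, DependsOn (fun b => remaining P b t = m)
      (pastPairs P t : Set (ℕ × ℕ)) := by
    intro t m b b' hbb
    have h : ∀ i ∈ pastPairs P t, b i = b' i := fun i hi => hbb i hi
    simp only [remaining_congr hP1 h]
  have hX : ∀ t, Measurable (X t) := fun t =>
    measurable_to_countable' fun m => hpast t _ (hdepX t m)
  set F : ℕ → Set Ω := fun t => {ω | pairAt t (walk P (fun i => B i ω) t) ∈ Finset.Icc 1 (P - 1) ∧
    ¬ B (t, pairAt t (walk P (fun i => B i ω) t)) ω}
  have hF : ∀ t, MeasurableSet (F t) := by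
    intro t
    refine measurableSet_of_dependsOn (b := B)
      (Φ := fun b => pairAt t (walk P b t) ∈ Finset.Icc 1 (P - 1) ∧ ¬ b (t, pairAt t (walk P b t)))
      (pastPairs P (t + 1)) (fun i hi => hB i.1 i.2 (Finset.mem_Icc.2 (mem_pastPairs.1 hi).2)) ?_
    intro b b' hbb
    have h : ∀ i ∈ pastPairs P t, b i = b' i :=
      fun i hi => hbb i (pastPairs_mono (Nat.le_succ t) hi)
    simp only [walk_congr hP1 h]
    refine propext (and_congr_right fun hp => not_congr ?_)
    rw [walk_congr hP1 h, hbb (t, pairAt t (walk P b' t)) (mem_pastPairs.2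
      ⟨Nat.lt_succ_self t, Finset.mem_Icc.1 hp⟩)]
  have hprob : ∀ t m, Pr.real ({ω | X t ω = m + 1} ∩ F t) ≤
      (1 - q) * Pr.real {ω | X t ω = m + 1} := by
    intro t m
    -- The relevant pair depends on the random position; fixing the position `z` makes it
    -- deterministic, so that `hind` applies.
    set Q : ℕ → Set Ω := fun z => {ω | (fun b => remaining P b t = m + 1 ∧ walk P b t = z)
      (fun i => B i ω)}
    have hQ : ∀ z, MeasurableSet (Q z) := fun z => hpast t _ (hdep t (m + 1) z)
    have hsub : {ω | X t ω = m + 1} ∩ F t ⊆ ⋃ z ∈ Finset.range (P + 1),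
        (Q z ∩ F t) := by
      rintro ω ⟨hω, hF⟩
      refine Set.mem_biUnion (x := walk P (fun i => B i ω) t) ?_ ⟨⟨hω, rfl⟩, hF⟩
      exact Finset.mem_coe.2 (Finset.mem_range.2 (Nat.lt_succ_of_le (walk_le hP1)))
    have hone : ∀ z, Pr.real (Q z ∩ F t) ≤ (1 - q) * Pr.real (Q z) := by
      intro z
      by_cases hz : pairAt t z ∈ Finset.Icc 1 (P - 1)
      · refine le_trans (measureReal_mono ?_) (hind t _ hz _ (hdep t (m + 1) z))
        rintro ω ⟨hω, hF⟩
        refine ⟨hω, ?_⟩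
        have h2 := hF.2
        rwa [hω.2] at h2
      · have : Q z ∩ F t = ∅ := by
          ext ω
          simp only [Set.mem_inter_iff, Set.mem_empty_iff_false, iff_false]
          rintro ⟨hω, hF⟩
          have h1 := hF.1
          rw [hω.2] at h1
          exact hz h1
        rw [this, measureReal_empty]
        exact mul_nonneg (by linarith) measureReal_nonneg
    have hdisj : Set.PairwiseDisjoint (↑(Finset.range (P + 1))) Q := by
      intro y _ z _ hyz
      refine Set.disjoint_left.2 fun ω hy hz => hyz ?_
      exact hy.2.symm.trans hz.2
    calc Pr.real ({ω | X t ω = m + 1} ∩ F t)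
        ≤ Pr.real (⋃ z ∈ Finset.range (P + 1), (Q z ∩ F t)) := measureReal_mono hsub (measure_ne_top _ _)
      _ ≤ ∑ z ∈ Finset.range (P + 1), Pr.real (Q z ∩ F t) :=
          measureReal_biUnion_finset_le _ _
      _ ≤ ∑ z ∈ Finset.range (P + 1), (1 - q) * Pr.real (Q z) := Finset.sum_le_sum fun z _ => hone z
      _ = (1 - q) * Pr.real (⋃ z ∈ Finset.range (P + 1), Q z) := by
          rw [← Finset.mul_sum, measureReal_biUnion_finset hdisj fun z _ => hQ z]
      _ ≤ (1 - q) * Pr.real {ω | X t ω = m + 1} := by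
          refine mul_le_mul_of_nonneg_left (measureReal_mono ?_) (by linarith)
          exact Set.iUnion₂_subset fun z _ ω hω => hω.1
  have hmain := tsum_measure_ne_zero_le (Pr := Pr) (X := X) (F := F) (M := 3 * P) hX
    (fun t ω => remaining_le hP1) hq hq1 hF
    (fun t ω h => (remaining_eq_zero_iff hP1).2
      (((remaining_eq_zero_iff hP1).1 h).mono (Nat.le_succ t)))
    (fun t ω m hm hω => remaining_succ_le hP hm fun hp => by
      by_contra hb
      exact hω ⟨hp, hb⟩) hprob
  have hne : ∀ t, MeasurableSet {ω | X t ω ≠ 0} := fun t => (hX t (measurableSet_singleton 0)).compl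
  calc ∫⁻ ω, ⨅ (t : ℕ) (_ : Returns P (fun i => B i ω) t), ((W * t : ℕ) : ENNReal) ∂Pr
      ≤ ∫⁻ ω, W * ∑' t, {ω | X t ω ≠ 0}.indicator 1 ω ∂Pr := by
        refine lintegral_mono fun ω => (iInf_returns_le hP1 hW).trans (le_of_eq ?_)
        rfl
    _ = W * ∑' t, Pr {ω | X t ω ≠ 0} := by
        rw [lintegral_const_mul _ (Measurable.tsum fun t =>
          measurable_one.indicator (hne t)), lintegral_tsum fun t =>
          (measurable_one.indicator (hne t)).aemeasurable]
        congr 1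
        exact tsum_congr fun t => lintegral_indicator_one (hne t)
    _ ≤ W * ENNReal.ofReal ((3 * P : ℕ) / q ^ (3 * P)) := by gcongr


/-! ### Independence of the swap attempts of different iterations. -/

/-- Events determined by disjoint finite sets of independent random variables are independent. -/
lemma measureReal_and_of_dependsOn {Ω ι : Type*} [MeasurableSpace Ω] {Pr : Measure Ω}
    {X : ι → Ω → ℝ} (hX : ∀ i, Measurable (X i)) (hind : iIndepFun X Pr)
    {S T : Finset ι} (hST : Disjoint S T) {Φ Ψ : (ι → ℝ) → Prop}
    (hΦ : MeasurableSet {x | Φ x}) (hΨ : MeasurableSet {x | Ψ x})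
    (hS : DependsOn Φ (S : Set ι)) (hT : DependsOn Ψ (T : Set ι)) :
    Pr.real {ω | Φ (fun i => X i ω) ∧ Ψ (fun i => X i ω)} =
      Pr.real {ω | Φ fun i => X i ω} * Pr.real {ω | Ψ fun i => X i ω} := by
  classical
  have hext : ∀ R : Finset ι, Measurable fun (v : R → ℝ) (i : ι) =>
      if h : i ∈ R then v ⟨i, h⟩ else 0 := by
    intro R
    refine measurable_pi_lambda _ fun i => ?_
    by_cases h : i ∈ R
    · simpa [h] using measurable_pi_apply _
    · simp [h]
  have hpre : ∀ (R : Finset ι) (Θ : (ι → ℝ) → Prop), DependsOn Θ (R : Set ι) →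
      {ω | Θ fun i => X i ω} = (fun ω (i : R) => X i ω) ⁻¹'
        ((fun (v : R → ℝ) (i : ι) => if h : i ∈ R then v ⟨i, h⟩ else 0) ⁻¹' {x | Θ x}) := by
    intro R Θ hΘ
    ext ω
    simp only [Set.mem_preimage, Set.mem_ofPred_eq]
    rw [hΘ]
    intro i hi
    simp [Finset.mem_coe.1 hi]
  have h := (hind.indepFun_finset S T hST hX).measure_inter_preimage_eq_mul _ _
    (hext S hΦ) (hext T hΨ)
  rw [← hpre S Φ hS, ← hpre T Ψ hT] at h
  simp only [Measure.real, ← ENNReal.toReal_mul, ← h]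
  rfl

lemma measurableSet_row {κ : Type*} {A : Set (κ → ℝ)} (hA : MeasurableSet A) (k : ℕ) :
    MeasurableSet {x : ℕ × κ → ℝ | (fun j => x (k, j)) ∈ A} :=
  (measurable_pi_lambda (fun (x : ℕ × κ → ℝ) j => x (k, j))
    fun j => measurable_pi_apply (k, j)) hA

section Rows

variable {Ω κ : Type*} [MeasurableSpace Ω] [Fintype κ] {Pr : Measure Ω}
  {X : ℕ × κ → Ω → ℝ}

/-- By independence the law of a row is the product of its marginals, which do not depend on the
iteration. -/
lemma measureReal_row_eq (hX : ∀ i, Measurable (X i)) (hind : iIndepFun X Pr)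
    (hlaw : ∀ k j, Pr.map (X (k, j)) = Pr.map (X (0, j))) {A : Set (κ → ℝ)}
    (hA : MeasurableSet A) (k : ℕ) :
    Pr.real {ω | (fun j => X (k, j) ω) ∈ A} = Pr.real {ω | (fun j => X (0, j) ω) ∈ A} := by
  have hmap : ∀ k, Pr.map (fun ω j => X (k, j) ω) = Measure.pi fun j => Pr.map (X (0, j)) := by
    intro k
    have h := (hind.precomp (Prod.mk_right_injective k)).map_fun_eq_pi_map
      fun j => (hX (k, j)).aemeasurable
    simpa only [hlaw k] using h
  have happ : ∀ k, Pr.real {ω | (fun j => X (k, j) ω) ∈ A} =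
      (Pr.map (fun ω j => X (k, j) ω)).real A := by
    intro k
    rw [map_measureReal_apply (measurable_pi_lambda _ fun j => hX (k, j)) hA]
    rfl
  rw [happ, happ, hmap, hmap]

lemma measureReal_forall_rows [IsProbabilityMeasure Pr] (hX : ∀ i, Measurable (X i)) (hind : iIndepFun X Pr)
    (hlaw : ∀ k j, Pr.map (X (k, j)) = Pr.map (X (0, j))) {A : Set (κ → ℝ)}
    (hA : MeasurableSet A) (a n : ℕ) :
    Pr.real {ω | ∀ k, a ≤ k → k < a + n → (fun j => X (k, j) ω) ∈ A} =
      Pr.real {ω | (fun j => X (0, j) ω) ∈ A} ^ n := by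
  classical
  induction n with
  | zero =>
    have : {ω | ∀ k, a ≤ k → k < a + 0 → (fun j => X (k, j) ω) ∈ A} = Set.univ := by
      ext ω
      simp only [Set.mem_ofPred_eq, Set.mem_univ, iff_true]
      intro k h1 h2
      omega
    rw [this]
    simp
  | succ n ih =>
    have hset : {ω | ∀ k, a ≤ k → k < a + (n + 1) → (fun j => X (k, j) ω) ∈ A} =
        {ω | (fun x : ℕ × κ → ℝ => ∀ k, a ≤ k → k < a + n → (fun j => x (k, j)) ∈ A)
            (fun i => X i ω) ∧
          (fun x : ℕ × κ → ℝ => (fun j => x (a + n, j)) ∈ A) (fun i => X i ω)} := by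
      ext ω
      simp only [Set.mem_ofPred_eq]
      constructor
      · exact fun h => ⟨fun k h1 h2 => h k h1 (by omega), h _ (by omega) (by omega)⟩
      · rintro ⟨h, h'⟩ k h1 h2
        rcases (by omega : k < a + n ∨ k = a + n) with h3 | rfl
        · exact h k h1 h3
        · exact h'
    refine (congrArg Pr.real hset).trans ((measureReal_and_of_dependsOn hX hind
      (S := Finset.range (a + n) ×ˢ Finset.univ) (T := {a + n} ×ˢ Finset.univ)
      (Φ := fun x => ∀ k, a ≤ k → k < a + n → (fun j => x (k, j)) ∈ A)
      (Ψ := fun x => (fun j => x (a + n, j)) ∈ A) ?_ ?_ ?_ ?_ ?_).trans ?_)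
    · rw [Finset.disjoint_left]
      simp only [Finset.mem_product, Finset.mem_range, Finset.mem_univ, and_true,
        Finset.mem_singleton]
      omega
    · refine MeasurableSet.congr (s := ⋂ k ∈ Finset.Ico a (a + n),
        {x : ℕ × κ → ℝ | (fun j => x (k, j)) ∈ A})
        (Finset.measurableSet_biInter _ fun k _ => measurableSet_row hA k) ?_
      ext x
      simp
    · exact measurableSet_row hA (a + n)
    · intro x y hxy
      refine propext (forall_congr' fun k => forall_congr' fun h1 => forall_congr' fun h2 => ?_)
      have : (fun j => x (k, j)) = fun j => y (k, j) := by
        funext j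
        exact hxy (k, j) (by simpa using h2)
      rw [this]
    · intro x y hxy
      have : (fun j => x (a + n, j)) = fun j => y (a + n, j) := by
        funext j
        exact hxy (a + n, j) (by simp)
      simp only [this]
    · rw [pow_succ, ← ih, ← measureReal_row_eq hX hind hlaw hA (a + n)]

/-- The mean round trip time, if the swap attempts of different iterations are independent and
every attempt is rejected with probability `r`. -/
theorem lintegral_iInf_returns_le_of_rows [IsProbabilityMeasure Pr] (hX : ∀ i, Measurable (X i)) (hind : iIndepFun X Pr)
    (hlaw : ∀ k j, Pr.map (X (k, j)) = Pr.map (X (0, j))) {A : ℕ → Set (κ → ℝ)}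
    (hA : ∀ p, MeasurableSet (A p)) {P W : ℕ} (hP : 2 ≤ P) (hW : 1 ≤ W) {r : ℝ} (hr0 : 0 ≤ r)
    (hr1 : r < 1)
    (hr : ∀ p ∈ Finset.Icc 1 (P - 1), Pr.real {ω | (fun j => X (0, j) ω) ∉ A p} = r) :
    ∫⁻ ω, ⨅ (t : ℕ) (_ : Returns P (fun i => ∃ k, i.1 * W ≤ k ∧ k < (i.1 + 1) * W ∧
        (fun j => X (k, j) ω) ∈ A i.2) t), ((W * t : ℕ) : ENNReal) ∂Pr ≤
      W * ENNReal.ofReal ((3 * P : ℕ) / (1 - r ^ W) ^ (3 * P)) := by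
  classical
  set b : ℕ × ℕ → (ℕ × κ → ℝ) → Prop := fun i x => ∃ k, i.1 * W ≤ k ∧ k < (i.1 + 1) * W ∧
        (fun j => x (k, j)) ∈ A i.2 with hb
  have hbmeas : ∀ i, MeasurableSet {x | b i x} := by
    intro i
    refine MeasurableSet.congr (s := ⋃ k ∈ Finset.Ico (i.1 * W) ((i.1 + 1) * W),
        {x : ℕ × κ → ℝ | (fun j => x (k, j)) ∈ A i.2})
        (Finset.measurableSet_biUnion _ fun k _ => measurableSet_row (hA _) k) ?_
    ext x
    simp [hb, and_assoc]
  have hbdep : ∀ i, DependsOn (b i)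
      ((Finset.Ico (i.1 * W) ((i.1 + 1) * W) ×ˢ Finset.univ : Finset (ℕ × κ)) : Set (ℕ × κ)) := by
    intro i x y hxy
    refine propext (exists_congr fun k => and_congr_right fun h1 => and_congr_right fun h2 => ?_)
    have : (fun j => x (k, j)) = fun j => y (k, j) := by
      funext j
      exact hxy (k, j) (by simp [h1, h2])
    rw [this]
  have hXm : Measurable fun ω i => X i ω := measurable_pi_lambda _ hX
  refine lintegral_iInf_returns_le hP hW (B := fun i ω => b i fun i => X i ω)
    (sub_pos.2 (pow_lt_one₀ hr0 hr1 (by omega))) (by linarith [pow_nonneg hr0 W])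
    (fun t p _ => hXm (hbmeas (t, p))) ?_
  intro t p hp Φ hΦ
  have hΦm : MeasurableSet {x : ℕ × κ → ℝ | Φ fun i => b i x} :=
    measurableSet_of_dependsOn (pastPairs P t) (fun i _ => hbmeas i) hΦ
  have hprod := measureReal_and_of_dependsOn hX hind (S := Finset.range (t * W) ×ˢ Finset.univ)
    (T := Finset.Ico (t * W) ((t + 1) * W) ×ˢ Finset.univ) (Φ := fun x => Φ fun i => b i x)
    (Ψ := fun x => ¬ b (t, p) x) ?_ hΦm (hbmeas (t, p)).compl ?_ ?_
  -- Failure in window `t` means `W` rejections in independent rows. Attempts within one row may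
  -- share energies; only different rows need be independent.
  · have hfail : Pr.real {ω | ¬ b (t, p) fun i => X i ω} = r ^ W := by
      rw [← hr p hp]
      refine Eq.trans ?_ (measureReal_forall_rows hX hind hlaw (hA p).compl (t * W) W)
      congr 1
      ext ω
      simp [hb, add_mul]
    rw [hprod, hfail, mul_comm]
    simp
  · rw [Finset.disjoint_left]
    simp only [Finset.mem_product, Finset.mem_range, Finset.mem_univ, and_true, Finset.mem_Ico]
    omega
  · intro x y hxy
    refine hΦ fun i hi => hbdep i fun l hl => hxy l ?_
    have hi := (mem_pastPairs.1 hi).1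
    have h1 : (i.1 + 1) * W ≤ t * W := Nat.mul_le_mul_right W hi
    simp only [Finset.coe_product, Set.mem_prod, Finset.coe_Ico, Set.mem_Ico, Finset.coe_univ,
      Set.mem_univ, and_true, Finset.coe_range, Set.mem_Iio] at hl ⊢
    omega
  · intro x y hxy
    simp only [hbdep (t, p) hxy]

end Rows


/-! ### Lower bounds for the laws of energies, noises and uniform variables. -/

/-- At temperatures between two temperatures at which the Gibbs distribution exists, the energy is
bounded by the same constant with a probability that is bounded below. -/
lemma exists_gibbs_abs_le {d : ℕ} {U : Space d → ℝ} (hU : Measurable U) {a b : ℝ} (ha : 0 < a)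
    (hia : Integrable (fun x => Real.exp (-U x / a)) volume)
    (hib : Integrable (fun x => Real.exp (-U x / b)) volume) :
    ∃ M c : ℝ, 0 ≤ M ∧ 0 < c ∧ ∀ T, a ≤ T → T ≤ b →
      c ≤ (gibbs U T).real {x | U x ∈ Set.Icc (-M) M} := by
  -- These bounded sets exhaust the space, so one of them has positive volume.
  obtain ⟨n, hn⟩ : ∃ n : ℕ, 0 < volume (U ⁻¹' Set.Icc (-(n : ℝ)) n ∩ Metric.ball 0 n) := by
    by_contra h
    push Not at h
    have huniv : (⋃ n : ℕ, U ⁻¹' Set.Icc (-(n : ℝ)) n ∩ Metric.ball (0 : Space d) n) =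
        Set.univ := by
      refine Set.eq_univ_of_forall fun x => Set.mem_iUnion.2 ?_
      obtain ⟨n, hn⟩ := exists_nat_gt (max |U x| ‖x‖)
      refine ⟨n, ⟨abs_le.1 ((le_max_left _ _).trans hn.le), ?_⟩⟩
      simpa using (le_max_right _ _).trans_lt hn
    have h0 : (volume : Measure (Space d)) Set.univ = 0 := by
      rw [← huniv]
      exact measure_iUnion_null fun n => le_antisymm (h n) bot_le
    exact (NeZero.ne (volume : Measure (Space d))) (Measure.measure_univ_eq_zero.1 h0)
  set s := U ⁻¹' Set.Icc (-(n : ℝ)) n ∩ Metric.ball (0 : Space d) n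
  have hsm : MeasurableSet s := (hU measurableSet_Icc).inter Metric.isOpen_ball.measurableSet
  have hsfin : volume s < ⊤ := (measure_mono Set.inter_subset_right).trans_lt
    (measure_ball_lt_top (x := (0 : Space d)) (r := n))
  have hspos : 0 < (volume : Measure (Space d)).real s :=
    ENNReal.toReal_pos hn.ne' hsfin.ne
  set Z := ∫ x, (Real.exp (-U x / a) + Real.exp (-U x / b)) with hZ
  have hZpos : 0 < Z := by
    rw [hZ, integral_add hia hib]
    exact add_pos (integral_exp_pos hia) (integral_exp_pos hib)
  refine ⟨n, Real.exp (-n / a) * (volume : Measure (Space d)).real s / Z, Nat.cast_nonneg n,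
    by positivity, fun T haT hTb => ?_⟩
  have hT : 0 < T := ha.trans_le haT
  have hb : 0 < b := hT.trans_le hTb
  -- According to the sign of `U x`, one of the two extreme temperatures dominates. This bounds all
  -- partition functions by `Z`.
  have hle : ∀ x, Real.exp (-U x / T) ≤ Real.exp (-U x / a) + Real.exp (-U x / b) := by
    intro x
    rcases le_total 0 (-U x) with h | h
    · have : Real.exp (-U x / T) ≤ Real.exp (-U x / a) :=
        Real.exp_le_exp.2 (div_le_div_of_nonneg_left h ha haT)
      linarith [Real.exp_pos (-U x / b)]
    · have : Real.exp (-U x / T) ≤ Real.exp (-U x / b) := by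
        refine Real.exp_le_exp.2 ?_
        rw [div_le_div_iff₀ hT hb]
        exact mul_le_mul_of_nonpos_left hTb h
      linarith [Real.exp_pos (-U x / a)]
  have hiT : Integrable (fun x => Real.exp (-U x / T)) volume := by
    refine (hia.add hib).mono' (by fun_prop) (Eventually.of_forall fun x => ?_)
    rw [Real.norm_of_nonneg (Real.exp_pos _).le]
    exact hle x
  have hZT : ∫ x, Real.exp (-U x / T) ≤ Z := integral_mono hiT (hia.add hib) hle
  have hZT0 : 0 < ∫ x, Real.exp (-U x / T) := integral_exp_pos hiT
  have : IsProbabilityMeasure (gibbs U T) := isProbabilityMeasure_tilted hiT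
  have hreal : (gibbs U T).real s
      = ∫ x in s, Real.exp (-U x / T) / ∫ x, Real.exp (-U x / T) := by
    rw [Measure.real, gibbs, tilted_apply_eq_ofReal_integral' _ hsm, ENNReal.toReal_ofReal]
    exact integral_nonneg fun x => by positivity
  have hsub : (gibbs U T).real s ≤ (gibbs U T).real {x | U x ∈ Set.Icc (-(n : ℝ)) n} :=
    measureReal_mono Set.inter_subset_left
  refine le_trans ?_ hsub
  rw [hreal, integral_div]
  refine div_le_div₀ (integral_nonneg fun x => by positivity) ?_ hZT0 hZT
  have hconst : Real.exp (-n / a) * (volume : Measure (Space d)).real s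
      = ∫ _x in s, Real.exp (-n / a) := by
    rw [setIntegral_const, smul_eq_mul, mul_comm]
  rw [hconst]
  refine setIntegral_mono_on (integrableOn_const hsfin.ne) hiT.integrableOn hsm
    fun x hx => Real.exp_le_exp.2 ?_
  have hx1 : U x ≤ n := hx.1.2
  have h1 : (n : ℝ) / T ≤ n / a := div_le_div_of_nonneg_left (Nat.cast_nonneg n) ha haT
  have h2 : U x / T ≤ n / T := by gcongr
  rw [neg_div, neg_div]
  linarith

lemma gaussianReal_Iic_zero (v : NNReal) :
    (gaussianReal 0 v).real (Set.Iic 0) = (gaussianReal 0 v).real (Set.Ici 0) := by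
  have h := gaussianReal_map_neg (μ := 0) (v := v)
  rw [neg_zero] at h
  conv_lhs => rw [← h]
  rw [map_measureReal_apply measurable_neg measurableSet_Iic]
  congr 1
  ext x
  simp

lemma half_le_gaussianReal_Ici_zero (v : NNReal) :
    1 / 2 ≤ (gaussianReal 0 v).real (Set.Ici 0) := by
  have h1 : (gaussianReal 0 v).real (Set.Iic 0 ∪ Set.Ici 0) ≤ _ :=
    measureReal_union_le (μ := gaussianReal 0 v) (Set.Iic 0) (Set.Ici 0)
  rw [Set.Iic_union_Ici, probReal_univ, gaussianReal_Iic_zero] at h1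
  linarith

lemma le_uniform_Iio {θ : ℝ} (h1 : θ ≤ 1) :
    θ ≤ ((volume : Measure ℝ).restrict (Set.Icc 0 1)).real (Set.Iio θ) := by
  have hsub : (volume : Measure ℝ).real (Set.Ico 0 θ) ≤
      ((volume : Measure ℝ).restrict (Set.Icc 0 1)).real (Set.Iio θ) := by
    rw [measureReal_restrict_apply measurableSet_Iio]
    refine measureReal_mono (fun x hx => ⟨hx.2, hx.1, hx.2.le.trans h1⟩) ?_
    exact ((measure_mono Set.inter_subset_right).trans_lt measure_Icc_lt_top).ne
  refine le_trans ?_ hsub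
  rw [measureReal_def, Real.volume_Ico, sub_zero]
  rw [ENNReal.toReal_ofReal']
  exact le_max_left _ _

namespace System

variable {d : ℕ} {Ω : Type*} {S : System d Ω}

/-! ### Spacing of the temperature ladder. -/

section Ladder

lemma Standing.τ_mono (hS : S.Standing) {P : ℕ} (hP : 2 ≤ P) {p q : ℕ} (hp : 1 ≤ p) (hpq : p ≤ q)
    (hq : q ≤ P) : S.τ P p ≤ S.τ P q := by
  induction q, hpq using Nat.le_induction with
  | base => exact le_rfl
  | succ q hpq ih =>
    exact (ih (by omega)).trans (hS.τ_lt P hP q (Finset.mem_Icc.2 ⟨by omega, by omega⟩)).le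

lemma Standing.τmin_le (hS : S.Standing) {P : ℕ} (hP : 2 ≤ P) {p : ℕ} (hp : 1 ≤ p) (hpP : p ≤ P) :
    S.τmin ≤ S.τ P p :=
  hS.τ_first P hP ▸ hS.τ_mono hP le_rfl hp hpP

lemma Standing.τ_le_max (hS : S.Standing) {P : ℕ} (hP : 2 ≤ P) {p : ℕ} (hp : 1 ≤ p)
    (hpP : p ≤ P) : S.τ P p ≤ S.τmax :=
  hS.τ_last P hP ▸ hS.τ_mono hP hp hpP le_rfl

/-- The ratio of neighbouring temperatures is `1 + O (1 / P)`. -/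
lemma exists_ratio_le (hS : S.Standing) (hB4 : S.ApproxGeometric) :
    ∃ K : ℝ, 0 ≤ K ∧ ∀ᶠ P : ℕ in atTop, ∀ p ∈ Finset.Icc 1 (P - 1),
      S.τ P (p + 1) / S.τ P p ≤ 1 + K / P := by
  set D := S.τmax / S.τmin with hD
  have hD1 : 1 < D := (one_lt_div hS.τmin_pos).2 hS.τmin_lt_τmax
  have hl : 0 < Real.log D := Real.log_pos hD1
  refine ⟨2 * Real.log D * D + 1, by positivity, ?_⟩
  filter_upwards [hB4 1 one_pos, eventually_ge_atTop 2] with P hP hP2 p hp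
  have h := (abs_le.1 (hP p hp)).2
  have hP2' : (2 : ℝ) ≤ P := by exact_mod_cast hP2
  set y := Real.log D * (1 / ((P : ℝ) - 1)) with hy
  have hy0 : 0 ≤ y := mul_nonneg hl.le (one_div_nonneg.2 (by linarith))
  have hyl : y ≤ Real.log D := by
    refine mul_le_of_le_one_right hl.le ?_
    rw [div_le_one (by linarith)]
    linarith
  have hyP : y ≤ 2 * Real.log D / P := by
    rw [hy, mul_one_div, div_le_div_iff₀ (by linarith) (by linarith)]
    nlinarith
  have hexp : D ^ (1 / ((P : ℝ) - 1)) = Real.exp y := by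
    rw [Real.rpow_def_of_pos (by linarith)]
  -- This is `1 - y ≤ exp (-y)` multiplied by `exp y`.
  have h1 : Real.exp y ≤ 1 + y * Real.exp y := by
    have h2 := Real.add_one_le_exp (-y)
    rw [Real.exp_neg] at h2
    have h3 := mul_le_mul_of_nonneg_right h2 (Real.exp_pos y).le
    rw [inv_mul_cancel₀ (Real.exp_pos y).ne'] at h3
    linarith
  have h2 : Real.exp y ≤ D := by
    rw [← Real.exp_log (by linarith : 0 < D)]
    exact Real.exp_le_exp.2 hyl
  have h3 : y * Real.exp y ≤ 2 * Real.log D / P * D := by gcongr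
  rw [hexp] at h
  have h4 : (2 * Real.log D * D + 1) / P = 2 * Real.log D / P * D + 1 / P := by ring
  linarith

lemma exists_inv_sub_inv_le (hS : S.Standing) (hB4 : S.ApproxGeometric) :
    ∃ K : ℝ, 0 ≤ K ∧ ∀ P : ℕ, 2 ≤ P → ∀ p ∈ Finset.Icc 1 (P - 1),
      P * (1 / S.τ P p - 1 / S.τ P (p + 1)) ≤ K := by
  obtain ⟨K, hK, hev⟩ := exists_ratio_le hS hB4
  obtain ⟨N, hN⟩ := eventually_atTop.1 hev
  have hmin := hS.τmin_pos
  refine ⟨(K + N) / S.τmin, by positivity, fun P hP p hp => ?_⟩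
  have hp' := Finset.mem_Icc.1 hp
  have h1 : S.τmin ≤ S.τ P p := hS.τmin_le hP hp'.1 (by omega)
  have h2 : S.τmin ≤ S.τ P (p + 1) := hS.τmin_le hP (by omega) (by omega)
  have hP0 : (0 : ℝ) < P := by exact_mod_cast (by omega : 0 < P)
  have h3 : 0 < S.τ P p := hmin.trans_le h1
  have h4 : 0 < S.τ P (p + 1) := hmin.trans_le h2
  rw [le_div_iff₀ hmin]
  by_cases hPN : N ≤ P
  · have h := hN P hPN p hp
    have h5 : 1 / S.τ P p - 1 / S.τ P (p + 1) = (S.τ P (p + 1) / S.τ P p - 1) / S.τ P (p + 1) := by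
      field_simp
    have h6 : 1 / S.τ P p - 1 / S.τ P (p + 1) ≤ K / P / S.τmin := by
      rw [h5]
      exact div_le_div₀ (by positivity) (by linarith) hmin h2
    calc P * (1 / S.τ P p - 1 / S.τ P (p + 1)) * S.τmin ≤ P * (K / P / S.τmin) * S.τmin := by gcongr
      _ = K := by field_simp
      _ ≤ K + N := by linarith [Nat.cast_nonneg (α := ℝ) N]
  -- The finitely many `P < N`, outside the asymptotic regime, are absorbed by the summand `N` of
  -- the constant.
  · have h5 : 1 / S.τ P p - 1 / S.τ P (p + 1) ≤ 1 / S.τmin := by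
      have : 1 / S.τ P p ≤ 1 / S.τmin := one_div_le_one_div_of_le hmin h1
      have : 0 < 1 / S.τ P (p + 1) := by positivity
      linarith
    have h6 : (P : ℝ) ≤ N := by exact_mod_cast (not_le.1 hPN).le
    calc P * (1 / S.τ P p - 1 / S.τ P (p + 1)) * S.τmin ≤ P * (1 / S.τmin) * S.τmin := by gcongr
      _ = P := by field_simp
      _ ≤ K + N := by linarith

/-- The spacing `O(1/P)` compensates noise growing like `P`; this keeps the bias correction in the
swap function bounded. -/
lemma exists_inv_sub_inv_mul_σ_le [MeasurableSpace Ω] {Pr : Measure Ω} (hS : S.Standing) (hB4 : S.ApproxGeometric)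
    (hC1 : S.EnergyNormality Pr) :
    ∃ K : ℝ, 0 ≤ K ∧ ∀ P : ℕ, 2 ≤ P → ∀ p ∈ Finset.Icc 1 (P - 1),
      (1 / S.τ P p - 1 / S.τ P (p + 1)) * S.σ P p ≤ K := by
  obtain ⟨K, hK, hb⟩ := exists_inv_sub_inv_le hS hB4
  obtain ⟨-, hs0, B, hB⟩ := hC1
  refine ⟨K * |B|, by positivity, fun P hP p hp => ?_⟩
  have hp' := Finset.mem_Icc.1 hp
  have hlt := hS.τ_lt P hP p hp
  have h1 : 0 < S.τ P p := hS.τmin_pos.trans_le (hS.τmin_le hP hp'.1 (by omega))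
  have hδ : 0 ≤ 1 / S.τ P p - 1 / S.τ P (p + 1) :=
    sub_nonneg.2 (one_div_le_one_div_of_le h1 hlt.le)
  have hbd : ∀ i ∈ Finset.Icc 1 P, S.s P i ^ 2 ≤ (|B| * P) ^ 2 := by
    intro i hi
    refine pow_le_pow_left₀ (hs0 P hP i hi) ((hB P hP i hi).trans ?_) 2
    gcongr
    exact le_abs_self B
  have hσ : S.σ P p ≤ |B| * P := by
    refine Real.sqrt_le_iff.2 ⟨by positivity, ?_⟩
    have h2 := hbd p (Finset.mem_Icc.2 ⟨hp'.1, by omega⟩)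
    have h3 := hbd (p + 1) (Finset.mem_Icc.2 ⟨by omega, by omega⟩)
    linarith
  calc (1 / S.τ P p - 1 / S.τ P (p + 1)) * S.σ P p
      ≤ (1 / S.τ P p - 1 / S.τ P (p + 1)) * (|B| * P) := by gcongr
    _ = P * (1 / S.τ P p - 1 / S.τ P (p + 1)) * |B| := by ring
    _ ≤ K * |B| := by
        gcongr
        exact hb P hP p hp

end Ladder

/-- Only one-sided bounds on the noisy energies enter, so the noises need a favourable sign but no
bounded size. -/
lemma le_swapFn {t₁ t₂ σ e₁ e₂ a M K : ℝ} (ha : 0 < a) (h1 : a ≤ t₁) (h12 : t₁ ≤ t₂)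
    (hM : 0 ≤ M) (hσ : 0 ≤ σ) (hK : (1 / t₁ - 1 / t₂) * σ ≤ K) (he₁ : -M ≤ e₁) (he₂ : e₂ ≤ M) :
    Real.exp (-(2 * M / a + K ^ 2)) ≤ swapFn t₁ t₂ σ e₁ e₂ := by
  have h1' : 0 < t₁ := ha.trans_le h1
  set δ := 1 / t₁ - 1 / t₂ with hδ
  have hδ0 : 0 ≤ δ := sub_nonneg.2 (one_div_le_one_div_of_le h1' h12)
  have hδa : δ ≤ 1 / a := by
    have : 1 / t₁ ≤ 1 / a := one_div_le_one_div_of_le ha h1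
    have : 0 < 1 / t₂ := one_div_pos.2 (h1'.trans_le h12)
    linarith
  have hK2 : (δ * σ) ^ 2 ≤ K ^ 2 := pow_le_pow_left₀ (mul_nonneg hδ0 hσ) hK 2
  have h2 : δ * (2 * M) ≤ 2 * M / a := by
    rw [div_eq_inv_mul, ← one_div]
    gcongr
  have h3 : δ * (-(2 * M)) ≤ δ * (e₁ - e₂) := mul_le_mul_of_nonneg_left (by linarith) hδ0
  refine le_min (Real.exp_le_one_iff.2 ?_) (Real.exp_le_exp.2 ?_)
  · have : 0 ≤ 2 * M / a := by positivity
    nlinarith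
  · rw [← hδ]
    linarith

/-! ### Acceptance probabilities and the mean round trip time for a given window. -/

section Sources

/-- The law of a source of randomness, at any iteration. -/
noncomputable def sourceLaw (S : System d Ω) (P p : ℕ) : Fin 3 → Measure ℝ
  | 0 => (gibbs S.U (S.τ P p)).map S.U
  | 1 => gaussianReal 0 (Real.toNNReal (S.s P p ^ 2))
  | 2 => (volume : Measure ℝ).restrict (Set.Icc 0 1)

/-- The coordinate `(p, i)` of a row of sources. -/
def rowEntry {P : ℕ} (p : ℕ) (i : Fin 3) (y : Finset.Icc 1 P × Fin 3 → ℝ) : ℝ :=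
  if h : p ∈ Finset.Icc 1 P then y (⟨p, h⟩, i) else 0

lemma measurable_rowEntry {P : ℕ} (p : ℕ) (i : Fin 3) :
    Measurable (rowEntry (P := P) p i) := by
  unfold rowEntry
  split_ifs
  · exact measurable_pi_apply _
  · exact measurable_const

/-- The rows of sources for which the swap attempt of `p` and `p + 1` is accepted. -/
def acceptSet (S : System d Ω) (P p : ℕ) : Set (Finset.Icc 1 P × Fin 3 → ℝ) :=
  {y | rowEntry p 2 y < swapFn (S.τ P p) (S.τ P (p + 1)) (S.σ P p)
    (rowEntry p 1 y + rowEntry p 0 y) (rowEntry (p + 1) 1 y + rowEntry (p + 1) 0 y)}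

lemma measurableSet_acceptSet (P p : ℕ) : MeasurableSet (S.acceptSet P p) := by
  have h := fun p i => measurable_rowEntry (P := P) p i
  refine measurableSet_lt (h _ _) ?_
  unfold swapFn
  fun_prop

lemma accepts_iff {P k p : ℕ} (hp : p ∈ Finset.Icc 1 (P - 1))
    {X : ℕ × (Finset.Icc 1 P × Fin 3) → Ω → ℝ} {ω : Ω}
    (h : ∀ i, S.source P i.1 i.2.1 i.2.2 ω = X i ω) :
    S.Accepts P k p ω ↔ (fun j => X (k, j) ω) ∈ S.acceptSet P p := by
  have hp' := Finset.mem_Icc.1 hp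
  have h1 : p ∈ Finset.Icc 1 P := Finset.mem_Icc.2 ⟨hp'.1, by omega⟩
  have h2 : p + 1 ∈ Finset.Icc 1 P := Finset.mem_Icc.2 ⟨by omega, by omega⟩
  simp only [acceptSet, Set.mem_ofPred_eq, rowEntry, h1, h2, dif_pos, ← h, source, Accepts,
    sub_add_cancel]

lemma index_eq_walk (P W : ℕ) (ω : Ω) (t : ℕ) :
    S.index P W ω t = walk P (fun i => S.WindowSwap P W i.1 i.2 ω) t := by
  classical
  induction t with
  | zero => rfl
  | succ t ih => simp only [index, walk, ih]

lemma roundTripTime_eq (P W : ℕ) (ω : Ω) :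
    S.roundTripTime P W ω = ⨅ (t : ℕ) (_ : Returns P (fun i => S.WindowSwap P W i.1 i.2 ω) t),
      ((W * t : ℕ) : ENNReal) := by
  unfold roundTripTime Returns Turned
  simp only [index_eq_walk]

variable [MeasurableSpace Ω] {Pr : Measure Ω}

lemma source_law (hS : S.Standing) (hB1 : S.Stationarity Pr) (hB2 : S.WeakIndependence Pr)
    (hC1 : S.EnergyNormality Pr) {P : ℕ} (hP : 2 ≤ P) (k : ℕ) {p : ℕ} (hp : p ∈ Finset.Icc 1 P)
    (i : Fin 3) :
    AEMeasurable (S.source P k p i) Pr ∧ Pr.map (S.source P k p i) = S.sourceLaw P p i := by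
  have hU : AEMeasurable (fun ω => S.U (S.β P k p ω)) Pr :=
    hS.measurable_U.comp_aemeasurable (hB1 P hP k p hp).1
  match i with
  | 0 =>
    refine ⟨hU, ?_⟩
    simp only [source, sourceLaw]
    rw [← (hB1 P hP k p hp).2, AEMeasurable.map_map_of_aemeasurable
      hS.measurable_U.aemeasurable (hB1 P hP k p hp).1]
    rfl
  | 1 => exact ⟨(hC1.1 P hP k p hp).1.sub hU, (hC1.1 P hP k p hp).2⟩
  | 2 => exact (hB2 P hP).1 k p hp

/-- The sources of randomness have measurable versions. -/
lemma exists_measurable_sources (hS : S.Standing) (hB1 : S.Stationarity Pr)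
    (hB2 : S.WeakIndependence Pr) (hC1 : S.EnergyNormality Pr) {P : ℕ} (hP : 2 ≤ P) :
    ∃ X : ℕ × (Finset.Icc 1 P × Fin 3) → Ω → ℝ, (∀ i, Measurable (X i)) ∧ iIndepFun X Pr ∧
      (∀ i, Pr.map (X i) = S.sourceLaw P i.2.1 i.2.2) ∧
      ∀ᵐ ω ∂Pr, ∀ i, S.source P i.1 i.2.1 i.2.2 ω = X i ω := by
  have h : ∀ i : ℕ × (Finset.Icc 1 P × Fin 3), _ := fun i =>
    source_law hS hB1 hB2 hC1 hP i.1 i.2.1.2 i.2.2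
  refine ⟨fun i => (h i).1.mk, fun i => (h i).1.measurable_mk, ?_, fun i => ?_, ?_⟩
  · exact (hB2 P hP).2.congr fun i => (h i).1.ae_eq_mk
  · rw [← (h i).2]
    exact (Measure.map_congr (h i).1.ae_eq_mk).symm
  -- The index set is countable, so a single null set serves all sources.
  · exact ae_all_iff.2 fun i => (h i).1.ae_eq_mk

/-- Five independent events force acceptance: both energies lie in `[-M, M]`, the noise of `p` is
nonnegative, that of `p + 1` is nonpositive, and the uniform variable is below `θ`. -/
lemma le_measureReal_acceptSet [IsProbabilityMeasure Pr] {P p : ℕ} (hp : p ∈ Finset.Icc 1 (P - 1))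
    {X : ℕ × (Finset.Icc 1 P × Fin 3) → Ω → ℝ} (hX : ∀ i, Measurable (X i))
    (hind : iIndepFun X Pr) (hlaw : ∀ i, Pr.map (X i) = S.sourceLaw P i.2.1 i.2.2)
    (hU : Measurable S.U) {M c θ : ℝ} (hc : 0 ≤ c) (hθ0 : 0 ≤ θ) (hθ1 : θ ≤ 1)
    (hgibbs : ∀ q ∈ Finset.Icc 1 P, c ≤ (gibbs S.U (S.τ P q)).real {x | S.U x ∈ Set.Icc (-M) M})
    (hswap : ∀ e₁ e₂, -M ≤ e₁ → e₂ ≤ M →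
      θ ≤ swapFn (S.τ P p) (S.τ P (p + 1)) (S.σ P p) e₁ e₂) :
    c * (1 / 2) * θ * c * (1 / 2) ≤ Pr.real {ω | (fun j => X (0, j) ω) ∈ S.acceptSet P p} := by
  have hp' := Finset.mem_Icc.1 hp
  have h1 : p ∈ Finset.Icc 1 P := Finset.mem_Icc.2 ⟨hp'.1, by omega⟩
  have h2 : p + 1 ∈ Finset.Icc 1 P := Finset.mem_Icc.2 ⟨by omega, by omega⟩
  set g : Fin 5 → ℕ × (Finset.Icc 1 P × Fin 3) := ![(0, ⟨p, h1⟩, 0), (0, ⟨p, h1⟩, 1),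
    (0, ⟨p, h1⟩, 2), (0, ⟨p + 1, h2⟩, 0), (0, ⟨p + 1, h2⟩, 1)] with hg
  have hginj : Function.Injective g := by
    intro i j
    fin_cases i <;> fin_cases j <;> simp [hg]
  set s : Fin 5 → Set ℝ := ![Set.Icc (-M) M, Set.Ici 0, Set.Iio θ, Set.Icc (-M) M, Set.Iic 0]
    with hs
  have hsm : ∀ i, MeasurableSet (s i) := by
    intro i
    fin_cases i
    · exact measurableSet_Icc
    · exact measurableSet_Ici
    · exact measurableSet_Iio
    · exact measurableSet_Icc
    · exact measurableSet_Iic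
  have hprod := (hind.precomp hginj).measure_inter_preimage_eq_mul Finset.univ
    (sets := s) fun i _ => hsm i
  have hreal : Pr.real (⋂ i ∈ Finset.univ, X (g i) ⁻¹' s i) =
      ∏ i, (Pr.map (X (g i))).real (s i) := by
    rw [Measure.real, hprod, ENNReal.toReal_prod]
    refine Finset.prod_congr rfl fun i _ => ?_
    rw [map_measureReal_apply (hX _) (hsm i)]
    rfl
  have hUM : ∀ q ∈ Finset.Icc 1 P, c ≤ ((gibbs S.U (S.τ P q)).map S.U).real (Set.Icc (-M) M) := by
    intro q hq
    rw [map_measureReal_apply hU measurableSet_Icc]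
    exact hgibbs q hq
  have hle : c * (1 / 2) * θ * c * (1 / 2) ≤ ∏ i, (Pr.map (X (g i))).real (s i) := by
    rw [Fin.prod_univ_five]
    simp only [hlaw]
    have e0 : c ≤ (S.sourceLaw P (g 0).2.1 (g 0).2.2).real (s 0) := hUM p h1
    have e1 : 1 / 2 ≤ (S.sourceLaw P (g 1).2.1 (g 1).2.2).real (s 1) :=
      half_le_gaussianReal_Ici_zero _
    have e2 : θ ≤ (S.sourceLaw P (g 2).2.1 (g 2).2.2).real (s 2) := le_uniform_Iio hθ1
    have e3 : c ≤ (S.sourceLaw P (g 3).2.1 (g 3).2.2).real (s 3) := hUM (p + 1) h2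
    have e4 : 1 / 2 ≤ (S.sourceLaw P (g 4).2.1 (g 4).2.2).real (s 4) :=
      (half_le_gaussianReal_Ici_zero _).trans_eq (gaussianReal_Iic_zero _).symm
    gcongr
  refine hle.trans (hreal.symm.le.trans (measureReal_mono fun ω hω => ?_))
  simp only [Finset.mem_univ, Set.iInter_true, Set.mem_iInter, Set.mem_preimage] at hω
  have w0 : X (0, ⟨p, h1⟩, 0) ω ∈ Set.Icc (-M) M := hω 0
  have w1 : X (0, ⟨p, h1⟩, 1) ω ∈ Set.Ici 0 := hω 1
  have w2 : X (0, ⟨p, h1⟩, 2) ω ∈ Set.Iio θ := hω 2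
  have w3 : X (0, ⟨p + 1, h2⟩, 0) ω ∈ Set.Icc (-M) M := hω 3
  have w4 : X (0, ⟨p + 1, h2⟩, 1) ω ∈ Set.Iic 0 := hω 4
  simp only [Set.mem_Icc, Set.mem_Ici, Set.mem_Iio, Set.mem_Iic] at w0 w1 w2 w3 w4
  simp only [Set.mem_ofPred_eq, acceptSet, rowEntry, h1, h2, dif_pos]
  exact w2.trans_le (hswap _ _ (by linarith) (by linarith))

lemma rejectionRate_eq {P p : ℕ} (hp : p ∈ Finset.Icc 1 (P - 1))
    {X : ℕ × (Finset.Icc 1 P × Fin 3) → Ω → ℝ}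
    (h : ∀ᵐ ω ∂Pr, ∀ i, S.source P i.1 i.2.1 i.2.2 ω = X i ω) :
    S.rejectionRate Pr P p = Pr.real {ω | (fun j => X (0, j) ω) ∉ S.acceptSet P p} := by
  refine measureReal_congr ?_
  filter_upwards [h] with ω hω
  exact propext (not_congr (accepts_iff hp hω))

/-- The rejection rates are bounded away from `1`. -/
lemma exists_rejectionRate_le [IsProbabilityMeasure Pr] (hS : S.Standing)
    (hB1 : S.Stationarity Pr) (hB2 : S.WeakIndependence Pr) (hB4 : S.ApproxGeometric)
    (hC1 : S.EnergyNormality Pr) :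
    ∃ a : ℝ, 0 < a ∧ ∀ P, 2 ≤ P → ∀ p ∈ Finset.Icc 1 (P - 1), S.rejectionRate Pr P p ≤ 1 - a := by
  obtain ⟨K, hK, hσ⟩ := exists_inv_sub_inv_mul_σ_le hS hB4 hC1
  obtain ⟨M, c, hM, hc, hgibbs⟩ := exists_gibbs_abs_le hS.measurable_U hS.τmin_pos
    hS.integrable_min hS.integrable_max
  set θ := Real.exp (-(2 * M / S.τmin + K ^ 2)) with hθ
  have hmin := hS.τmin_pos
  have hθ1 : θ ≤ 1 := Real.exp_le_one_iff.2 (by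
    have : 0 ≤ 2 * M / S.τmin := by positivity
    nlinarith)
  refine ⟨c * (1 / 2) * θ * c * (1 / 2), by positivity, fun P hP p hp => ?_⟩
  have hp' := Finset.mem_Icc.1 hp
  obtain ⟨X, hX, hind, hlaw, hae⟩ := exists_measurable_sources hS hB1 hB2 hC1 hP
  have hle := le_measureReal_acceptSet (S := S) hp hX hind hlaw hS.measurable_U (M := M) hc.le
    (Real.exp_pos _).le hθ1 (fun q hq => hgibbs _
      (hS.τmin_le hP (Finset.mem_Icc.1 hq).1 (Finset.mem_Icc.1 hq).2)
      (hS.τ_le_max hP (Finset.mem_Icc.1 hq).1 (Finset.mem_Icc.1 hq).2))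
    (fun e₁ e₂ he₁ he₂ => le_swapFn hmin (hS.τmin_le hP hp'.1 (by omega)) (hS.τ_lt P hP p hp).le
      hM (Real.sqrt_nonneg _) (hσ P hP p hp) he₁ he₂)
  have hm : MeasurableSet {ω | (fun j => X (0, j) ω) ∈ S.acceptSet P p} :=
    (measurable_pi_lambda _ fun j => hX (0, j)) (measurableSet_acceptSet P p)
  have hcompl := probReal_compl_eq_one_sub (μ := Pr) hm
  rw [rejectionRate_eq hp hae]
  have : {ω | (fun j => X (0, j) ω) ∉ S.acceptSet P p} =
      {ω | (fun j => X (0, j) ω) ∈ S.acceptSet P p}ᶜ := rfl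
  rw [this, hcompl]
  linarith

/-- The mean round trip time for windows of size `W`. -/
theorem expectedRoundTrip_le [IsProbabilityMeasure Pr] (hS : S.Standing)
    (hB1 : S.Stationarity Pr) (hB2 : S.WeakIndependence Pr) (hC1 : S.EnergyNormality Pr)
    (hEA : S.EquiAcceptance Pr) {P W : ℕ} (hP : 2 ≤ P) (hW : 1 ≤ W)
    (hr : S.rejectionRate Pr P 1 < 1) :
    S.expectedRoundTrip Pr P W ≤
      W * ENNReal.ofReal ((3 * P : ℕ) / (1 - S.rejectionRate Pr P 1 ^ W) ^ (3 * P)) := by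
  obtain ⟨X, hX, hind, hlaw, hae⟩ := exists_measurable_sources hS hB1 hB2 hC1 hP
  refine le_trans (le_of_eq ?_) (lintegral_iInf_returns_le_of_rows hX hind
    (fun k j => (hlaw (k, j)).trans (hlaw (0, j)).symm) (A := S.acceptSet P)
    (measurableSet_acceptSet P) hP hW measureReal_nonneg hr
    (fun p hp => (rejectionRate_eq hp hae).symm.trans (hEA P hP p hp)))
  refine lintegral_congr_ae ?_
  filter_upwards [hae] with ω hω
  rw [roundTripTime_eq]
  refine iInf_congr fun t => ?_
  have : Returns P (fun i => S.WindowSwap P W i.1 i.2 ω) t = Returns P (fun i => ∃ k,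
      i.1 * W ≤ k ∧ k < (i.1 + 1) * W ∧ (fun j => X (k, j) ω) ∈ S.acceptSet P i.2) t := by
    refine returns_congr (by omega) fun i hi => ?_
    have hi := Finset.mem_Icc.2 (mem_pastPairs.1 hi).2
    unfold WindowSwap
    simp only [accepts_iff hi hω]
  rw [this]

end Sources

end System


/-! ### The explicit window size and the final estimates. -/

lemma half_lt_log_of_two_le {x : ℝ} (hx : 2 ≤ x) : 0.69 < Real.log x := by
  have := Real.log_two_gt_d9
  have := Real.log_le_log (by norm_num) hx
  linarith

/-- Almost no swaps fail if the failure probability is at most `1 / (P log P)`. -/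
lemma exp_neg_le_one_sub_pow {P : ℕ} (hP : 2 ≤ P) {ρ : ℝ} (hρ0 : 0 ≤ ρ)
    (hρ : ρ * (P * Real.log P) ≤ 1) : ρ < 1 ∧ Real.exp (-17) ≤ (1 - ρ) ^ (3 * P) := by
  have hP' : (2 : ℝ) ≤ P := by exact_mod_cast hP
  have hl := half_lt_log_of_two_le hP'
  have h1 : ρ * P ≤ 1.45 := by
    have : ρ * P * 0.69 ≤ ρ * P * Real.log P := by gcongr
    nlinarith
  have h2 : ρ ≤ 0.725 := by nlinarith
  refine ⟨by linarith, ?_⟩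
  have h3 : 0 < 1 - ρ := by linarith
  rw [← Real.exp_log (pow_pos h3 (3 * P)), Real.exp_le_exp, Real.log_pow]
  have h4 := Real.one_sub_inv_le_log_of_pos h3
  have h5 : -(ρ / 0.275) ≤ Real.log (1 - ρ) := by
    refine le_trans ?_ h4
    have h6 : 1 - (1 - ρ)⁻¹ = -(ρ / (1 - ρ)) := by field_simp; ring
    rw [h6]
    gcongr
    linarith
  -- The exponent is at least `-(3 / 0.275) · 1.45 > -17`.
  have h7 : ((3 * P : ℕ) : ℝ) * -(ρ / 0.275) ≤ ((3 * P : ℕ) : ℝ) * Real.log (1 - ρ) := by gcongr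
  refine le_trans ?_ h7
  push_cast
  have h8 : 3 * (P : ℝ) * -(ρ / 0.275) = -(3 / 0.275 * (ρ * P)) := by ring
  rw [h8]
  linarith

namespace System

variable {d : ℕ} {Ω : Type*} {S : System d Ω}

lemma μ_order_ge (P p : ℕ) (hP : 2 ≤ P) :
    P * Real.log P ≤ order (S.μ P p) P := by
  have hP' : (2 : ℝ) ≤ P := by exact_mod_cast hP
  have hl := half_lt_log_of_two_le hP'
  refine le_mul_of_one_le_right (by nlinarith) (Real.one_le_exp (by positivity))

/-- Since `8 μ² = 9 g²` for the bracket `g` in `hf`, the hypothesis gives `x² > 1.035 g²`, whereas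
`1.01² < 1.035`; if `g = 0`, then `x ≥ 4` suffices. -/
lemma lt_of_sq_μ_lt {P q : ℕ} {x f : ℝ} (hx : 4 ≤ x) (hμ : 0.92 * S.μ P q ^ 2 < x ^ 2)
    (hf : f ≤ 1.01 * (S.σ P q / (3 * S.τ P (q + 1)) * Real.log (S.τmax / S.τmin))) : f < x := by
  have h2 : Real.sqrt 2 ^ 2 = 2 := Real.sq_sqrt (by norm_num)
  have hsq : 8 * S.μ P q ^ 2 =
      9 * (S.σ P q / (3 * S.τ P (q + 1)) * Real.log (S.τmax / S.τmin)) ^ 2 := by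
    unfold μ
    have h3 : S.σ P q / (3 * S.τ P (q + 1)) = S.σ P q / S.τ P (q + 1) / 3 := by
      rw [div_div, mul_comm]
    rw [h3, div_pow _ (2 * Real.sqrt 2), mul_pow 2 (Real.sqrt 2), h2]
    ring
  refine hf.trans_lt (lt_of_pow_lt_pow_left₀ 2 (by linarith) ?_)
  rw [mul_pow]
  nlinarith [sq_nonneg (S.σ P q / (3 * S.τ P (q + 1)) * Real.log (S.τmax / S.τmin))]

/-- Replacing the upper temperature by the lower one costs the ratio `1 + O(1/P)`, which is at most
`1.01` once `P ≥ 100 K`. -/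
lemma eventually_lower_le (hS : S.Standing) (hB4 : S.ApproxGeometric) :
    ∀ᶠ P : ℕ in atTop, ∀ q ∈ Finset.Icc 1 (P - 1),
      S.σ P q / (3 * S.τ P q) * Real.log (S.τmax / S.τmin) ≤
        1.01 * (S.σ P q / (3 * S.τ P (q + 1)) * Real.log (S.τmax / S.τmin)) := by
  obtain ⟨K, hK, hev⟩ := exists_ratio_le hS hB4
  filter_upwards [hev, eventually_ge_atTop (max 2 ⌈100 * K⌉₊)] with P hP hPK q hq
  have hq' := Finset.mem_Icc.1 hq
  have hP2 : 2 ≤ P := (le_max_left _ _).trans hPK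
  have hP0 : (0 : ℝ) < P := by exact_mod_cast (by omega : 0 < P)
  have hPK' : 100 * K ≤ P := (Nat.le_ceil _).trans (by exact_mod_cast (le_max_right _ _).trans hPK)
  have h1 : K / P ≤ 0.01 := by
    rw [div_le_iff₀ hP0]
    linarith
  have h2 : 0 < S.τ P q := hS.τmin_pos.trans_le (hS.τmin_le hP2 hq'.1 (by omega))
  have h3 : 0 < S.τ P (q + 1) := hS.τmin_pos.trans_le (hS.τmin_le hP2 (by omega) (by omega))
  have h4 := hP q hq
  have h5 : S.τ P (q + 1) / S.τ P q ≤ 1.01 := by linarith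
  have hl : 0 ≤ Real.log (S.τmax / S.τmin) :=
    Real.log_nonneg ((one_le_div hS.τmin_pos).2 hS.τmin_lt_τmax.le)
  have hσ : 0 ≤ S.σ P q := Real.sqrt_nonneg _
  have h6 : S.σ P q / (3 * S.τ P q) * Real.log (S.τmax / S.τmin) =
      S.τ P (q + 1) / S.τ P q *
        (S.σ P q / (3 * S.τ P (q + 1)) * Real.log (S.τmax / S.τmin)) := by
    field_simp
  rw [h6]
  gcongr

variable [MeasurableSpace Ω] {Pr : Measure Ω}

lemma one_le_optWindow (P : ℕ) : 1 ≤ S.optWindow Pr P := le_max_left _ _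

lemma optWindow_le {P : ℕ} (hP : 2 ≤ P) {a : ℝ} (ha : 0 < a)
    (hr : S.rejectionRate Pr P 1 ≤ 1 - a) :
    (S.optWindow Pr P : ℝ) ≤ (4 + 2 / a) * Real.log P := by
  have hP' : (2 : ℝ) ≤ P := by exact_mod_cast hP
  have hl := half_lt_log_of_two_le hP'
  have hr0 : 0 ≤ S.rejectionRate Pr P 1 := measureReal_nonneg
  set r := S.rejectionRate Pr P 1 with hrdef
  have hll : Real.log (Real.log P) ≤ Real.log P :=
    (Real.log_le_sub_one_of_pos (by linarith)).trans (by linarith)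
  have hdiv : (Real.log P + Real.log (Real.log P)) / (-Real.log r) ≤ 2 / a * Real.log P := by
    rcases hr0.eq_or_lt with h | h
    · rw [← h]
      -- For `r = 0` the quotient has the default value `0`, so the window is `1`.
      simp only [Real.log_zero, neg_zero, div_zero]
      have : 0 < Real.log P := by linarith
      positivity
    · have h1 : a ≤ -Real.log r := by
        have := Real.log_le_sub_one_of_pos h
        linarith
      have h2 : (Real.log P + Real.log (Real.log P)) / (-Real.log r)
          ≤ 2 * Real.log P / (-Real.log r) :=
        div_le_div_of_nonneg_right (by linarith) (by linarith)
      refine h2.trans ?_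
      have h3 : 2 * Real.log P / (-Real.log r) ≤ 2 * Real.log P / a :=
        div_le_div_of_nonneg_left (by linarith) ha h1
      refine h3.trans (le_of_eq (by ring))
  have h0 : 0 ≤ 2 / a * Real.log P := by
    have : 0 < Real.log P := by linarith
    positivity
  have hceil : (⌈(Real.log P + Real.log (Real.log P)) / (-Real.log r)⌉₊ : ℝ)
      ≤ 2 / a * Real.log P + 1 :=
    (Nat.cast_le.2 (Nat.ceil_mono hdiv)).trans (Nat.ceil_lt_add_one h0).le
  unfold optWindow
  rw [Nat.cast_max]
  refine max_le ?_ ?_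
  · push_cast; nlinarith
  · rw [← hrdef]; nlinarith

/-- The window size is chosen for this: `W log r ≤ -(log P + log log P)`. -/
lemma rejectionRate_pow_optWindow_le {P : ℕ} (hP : 2 ≤ P) (hr : S.rejectionRate Pr P 1 < 1) :
    S.rejectionRate Pr P 1 ^ S.optWindow Pr P * (P * Real.log P) ≤ 1 := by
  have hP' : (2 : ℝ) ≤ P := by exact_mod_cast hP
  have hl := half_lt_log_of_two_le hP'
  have hl0 : 0 < Real.log P := by linarith
  have hr0 : 0 ≤ S.rejectionRate Pr P 1 := measureReal_nonneg
  have hW := one_le_optWindow (S := S) (Pr := Pr) P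
  have hWle : (Real.log P + Real.log (Real.log P)) / (-Real.log (S.rejectionRate Pr P 1)) ≤
      (S.optWindow Pr P : ℝ) :=
    (Nat.le_ceil _).trans (Nat.cast_le.2 (le_max_right _ _))
  set r := S.rejectionRate Pr P 1
  rcases hr0.eq_or_lt with h | h
  · rw [← h, zero_pow (by omega)]
    simp
  · have hlog : 0 < -Real.log r := neg_pos.2 (Real.log_neg h hr)
    rw [div_le_iff₀ hlog] at hWle
    rw [← Real.exp_log (pow_pos h _), Real.log_pow,
      ← Real.exp_log (by positivity : 0 < (P : ℝ) * Real.log P),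
      Real.log_mul (by positivity) hl0.ne', ← Real.exp_add]
    exact Real.exp_le_one_iff.2 (by linarith)

/-- The round trip time has the order `P log P`, and a fortiori the order of `PT.order`. -/
theorem exists_expectedRoundTrip_le [IsProbabilityMeasure Pr] (hS : S.Standing)
    (hB1 : S.Stationarity Pr) (hB2 : S.WeakIndependence Pr) (hB4 : S.ApproxGeometric)
    (hC1 : S.EnergyNormality Pr) (hEA : S.EquiAcceptance Pr) :
    ∃ C : ℝ, 0 < C ∧ ∀ P : ℕ, 2 ≤ P →
      S.expectedRoundTrip Pr P (S.optWindow Pr P) ≤ ENNReal.ofReal (C * (P * Real.log P)) := by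
  obtain ⟨a, ha, hrate⟩ := exists_rejectionRate_le hS hB1 hB2 hB4 hC1
  refine ⟨(4 + 2 / a) * 3 * Real.exp 17, by positivity, fun P hP => ?_⟩
  have hr := hrate P hP 1 (Finset.mem_Icc.2 ⟨le_rfl, by omega⟩)
  have hr1 : S.rejectionRate Pr P 1 < 1 := by linarith
  have hr0 : 0 ≤ S.rejectionRate Pr P 1 := measureReal_nonneg
  refine (expectedRoundTrip_le hS hB1 hB2 hC1 hEA hP (one_le_optWindow P) hr1).trans ?_
  have hW := optWindow_le hP ha hr
  obtain ⟨-, hpow⟩ := exp_neg_le_one_sub_pow hP (pow_nonneg hr0 (S.optWindow Pr P))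
    (rejectionRate_pow_optWindow_le hP hr1)
  set W := S.optWindow Pr P
  set q := (1 - S.rejectionRate Pr P 1 ^ W) ^ (3 * P)
  have hP' : (2 : ℝ) ≤ P := by exact_mod_cast hP
  have hl := half_lt_log_of_two_le hP'
  have h1 : ((3 * P : ℕ) : ℝ) / q ≤ 3 * P * Real.exp 17 := by
    have : ((3 * P : ℕ) : ℝ) / q ≤ ((3 * P : ℕ) : ℝ) / Real.exp (-17) :=
      div_le_div_of_nonneg_left (Nat.cast_nonneg _) (Real.exp_pos _) hpow
    rw [Real.exp_neg, div_inv_eq_mul] at this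
    exact_mod_cast this
  rw [← ENNReal.ofReal_natCast, ← ENNReal.ofReal_mul (Nat.cast_nonneg _)]
  refine ENNReal.ofReal_le_ofReal ?_
  calc (W : ℝ) * (((3 * P : ℕ) : ℝ) / q)
      ≤ ((4 + 2 / a) * Real.log P) * (3 * P * Real.exp 17) := by
        have : 0 ≤ ((3 * P : ℕ) : ℝ) / q :=
          div_nonneg (Nat.cast_nonneg _) ((Real.exp_pos _).le.trans hpow)
        have : 0 ≤ (W : ℝ) := Nat.cast_nonneg _
        gcongr
    _ = (4 + 2 / a) * 3 * Real.exp 17 * (P * Real.log P) := by ring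

end System

end PT

theorem mainTheorem5 {d : ℕ} {Ω : Type*} [MeasurableSpace Ω] (Pr : MeasureTheory.Measure Ω)
    [MeasureTheory.IsProbabilityMeasure Pr] (S : PT.System d Ω) (hS : S.Standing)
    (hB1 : S.Stationarity Pr) (hB2 : S.WeakIndependence Pr) (hB3 : S.Integrability)
    (hB4 : S.ApproxGeometric) (hC1 : S.EnergyNormality Pr) (hEA : S.EquiAcceptance Pr) :
    -- the round trip time with the optimal window size
    (∃ C : ℝ, 0 < C ∧ ∀ P : ℕ, 2 ≤ P → ∀ W : ℕ,
      (W = S.optWindow Pr P ∨ S.IsOptimalWindow Pr P W) → ∀ p ∈ Finset.Icc 1 (P - 1),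
        S.expectedRoundTrip Pr P W ≤ ENNReal.ofReal (C * PT.order (S.μ P p) P)) ∧
    -- the optimal number of chains exists, and is unique as a continuous variable
    (∀ P : ℕ, 2 ≤ P → ∀ q ∈ Finset.Icc 1 (P - 1),
      (∃! x : ℝ, PT.IsOptimalReal (S.μ P q) x) ∧ ∃ n : ℕ, PT.IsOptimalNat (S.μ P q) n) ∧
    -- its lower bound, for every ladder, with the temperature of the upper chain of each pair
    (∀ P : ℕ, 2 ≤ P → ∀ q ∈ Finset.Icc 1 (P - 1), ∀ x : ℝ,
      (PT.IsOptimalReal (S.μ P q) x ∨ ∃ n : ℕ, x = n ∧ PT.IsOptimalNat (S.μ P q) n) →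
        PT.minPairs P (fun p => S.σ P p / (3 * S.τ P (p + 1)) * Real.log (S.τmax / S.τmin))
          < x) ∧
    -- its lower bound, for every large ladder, with the temperature of the lower chain
    (∀ᶠ P : ℕ in Filter.atTop, ∀ q ∈ Finset.Icc 1 (P - 1), ∀ x : ℝ,
      (PT.IsOptimalReal (S.μ P q) x ∨ ∃ n : ℕ, x = n ∧ PT.IsOptimalNat (S.μ P q) n) →
        PT.minPairs P (fun p => S.σ P p / (3 * S.τ P p) * Real.log (S.τmax / S.τmin))
          < x) := by
  refine ⟨?_, fun P _ q _ => ⟨PT.existsUnique_isOptimalReal _, PT.exists_isOptimalNat _⟩, ?_, ?_⟩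
  · obtain ⟨C, hC, hbound⟩ := PT.System.exists_expectedRoundTrip_le hS hB1 hB2 hB4 hC1 hEA
    refine ⟨C, hC, fun P hP W hW p _ => ?_⟩
    have hle : S.expectedRoundTrip Pr P W ≤ S.expectedRoundTrip Pr P (S.optWindow Pr P) := by
      rcases hW with rfl | hW
      · exact le_rfl
      · exact hW.2 _ (PT.System.one_le_optWindow P)
    refine hle.trans ((hbound P hP).trans (ENNReal.ofReal_le_ofReal ?_))
    exact mul_le_mul_of_nonneg_left (PT.System.μ_order_ge P p hP) hC.le
  · intro P hP q hq x hx
    obtain ⟨h4, hμ⟩ := PT.sq_lt_of_isOptimal hx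
    refine (PT.minPairs_le _ hq).trans_lt (PT.System.lt_of_sq_μ_lt h4 hμ ?_)
    have hq' := Finset.mem_Icc.1 hq
    have h3 : 0 < S.τ P (q + 1) :=
      hS.τmin_pos.trans_le (hS.τmin_le hP (by omega) (by omega))
    have hl : 0 ≤ Real.log (S.τmax / S.τmin) :=
      Real.log_nonneg ((one_le_div hS.τmin_pos).2 hS.τmin_lt_τmax.le)
    have hσ : 0 ≤ S.σ P q := Real.sqrt_nonneg _
    exact le_mul_of_one_le_left (by positivity) (by norm_num)
  · filter_upwards [PT.System.eventually_lower_le hS hB4] with P hP q hq x hx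
    obtain ⟨h4, hμ⟩ := PT.sq_lt_of_isOptimal hx
    exact (PT.minPairs_le _ hq).trans_lt (PT.System.lt_of_sq_μ_lt h4 hμ (hP q hq))
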